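/- Let $n\ge 3$, let $2\le d_1\le\dots\le d_n$ be integers, and let $S=\mathbb{C}[x_1,\dots,x_n]=\bigoplus_m S_m$ with the standard grading. Put $T=\sum_{j=1}^n d_j-n$. For ${\bf f}=(f_1,\dots,f_n)\in S_{d_1}\times\dots\times S_{d_n}$ let $J({\bf f})=(f_1,\dots,f_n)$ and $M({\bf f})=S/J({\bf f})$; call ${\bf f}$ a $0$-dimensional complete intersection of multidegree ${\bf d}=(d_1,\dots,d_n)$ if $M({\bf f})$ has Krull dimension $0$. For such ${\bf f}$ there is a linear isomorphism $\omega:\mathrm{Soc}(M({\bf f}))\to\mathbb{C}$, necessarily unique, that takes the value $1$ on the class of $\mathrm{Jac}({\bf f})=\det(\partial f_i/\partial x_j)$, where $\mathrm{Soc}(M({\bf f}))$ is the set of elements annihilated by $x_1,\dots,x_n$, and the associated form $$A_{\bf f}(y_1,\dots,y_n)=\omega\big((y_1\overline{x_1}+\dots+y_n\overline{x_n})^T\big)\in\mathbb{C}[y_1,\dots,y_n]$$ is well defined. Let $\mathcal V_n^{T-1}\subset\mathbb{P}(S_{T-1})$ be the Veronese variety, the image of $\mathbb{P}(S_1)\to\mathbb{P}(S_{T-1})$,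 $\ell\mapsto\ell^{T-1}$. (a) For every $0$-dimensional complete intersection ${\bf f}$ of multidegree ${\bf d}$ the following two conditions are equivalent. (1) The projective hypersurface $A_{\bf f}(y_1,\dots,y_n)=0$ in $\mathbb{P}^{n-1}$ is smooth, that is, $A_{\bf f}$ and its partial derivatives have no common zero in $\mathbb{C}^n\setminus\{0\}$. (2) $\mathbb{P}(J({\bf f})_{T-1})\cap\mathcal V_n^{T-1}=\emptyset$ in $\mathbb{P}(S_{T-1})$. (b) There is a nonempty Zariski open subset $U$ of the affine space $S_{d_1}\times\dots\times S_{d_n}$ such that every ${\bf f}\in U$ is a $0$-dimensional complete intersection of multidegree ${\bf d}$ and satisfies (1) and (2). -/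

import Mathlib

open MvPolynomial
open scoped LinearAlgebra.Projectivization

namespace CompleteIntersection

/-- The polynomial ring `S = ℂ[x_1, …, x_n]`. -/
abbrev S (n : ℕ) : Type := MvPolynomial (Fin n) ℂ

/-- The space `S_m` of forms of degree `m`. -/
noncomputable abbrev Forms (n m : ℕ) : Submodule ℂ (S n) := homogeneousSubmodule (Fin n) ℂ m

/-- The ideal `J(f) = (f_1, …, f_n)`. -/
noncomputable def J {n : ℕ} (f : Fin n → S n) : Ideal (S n) := Ideal.span (Set.range f)

/-- The algebra `M(f) = S / J(f)`. -/
abbrev M {n : ℕ} (f : Fin n → S n) : Type := S n ⧸ J f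

/-- `f` is an `n`-tuple of forms with `deg f_j = d_j` for which `S / J(f)` has Krull dimension `0`,
so that the `n` forms generate an ideal of codimension `n`. -/
structure IsZeroDimCI {n : ℕ} (d : Fin n → ℕ) (f : Fin n → S n) : Prop where
  homogeneous : ∀ j, (f j).IsHomogeneous (d j)
  dim_zero : ringKrullDim (M f) = 0

/-- The socle degree `T = d_1 + ⋯ + d_n - n` (only used when all `d_j ≥ 2`, where the subtraction
does not truncate). -/
def socleDegree {n : ℕ} (d : Fin n → ℕ) : ℕ := (∑ j, d j) - n

/-- The socle of `M(f)`: the elements killed by the maximal ideal `(x_1, …, x_n)`. -/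
noncomputable def socle {n : ℕ} (f : Fin n → S n) : Submodule ℂ (M f) where
  carrier := {m | ∀ i, Ideal.Quotient.mk (J f) (X i) * m = 0}
  zero_mem' := by intro i; simp
  add_mem' := by intro a b ha hb i; rw [mul_add, ha i, hb i, add_zero]
  smul_mem' := by intro c a ha i; rw [mul_smul_comm, ha i, smul_zero]

/-- The determinant of the Jacobian matrix of `f : ℂⁿ → ℂⁿ`. -/
noncomputable def jac {n : ℕ} (f : Fin n → S n) : S n :=
  (Matrix.of fun i j => pderiv j (f i)).det

/-- `A` is the associated form of `f`: there is a linear isomorphism `ω : Soc(M(f)) ≃ ℂ` with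
`ω(Jac(f)) = 1` such that `A(y) = ω((y_1 x_1 + ⋯ + y_n x_n)^T)` for all `y`. (That the two classes
to which `ω` is applied lie in the socle is part of the definition. Polynomials over `ℂ` and
polynomial functions are the same thing.) -/
def IsAssociatedForm {n : ℕ} (d : Fin n → ℕ) (f : Fin n → S n)
    (A : MvPolynomial (Fin n) ℂ) : Prop :=
  ∃ ω : socle f ≃ₗ[ℂ] ℂ,
    (∃ h : Ideal.Quotient.mk (J f) (jac f) ∈ socle f, ω ⟨_, h⟩ = 1) ∧
    ∀ y : Fin n → ℂ,
      ∃ h : (∑ i, y i • Ideal.Quotient.mk (J f) (X i)) ^ socleDegree d ∈ socle f,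
        eval y A = ω ⟨_, h⟩

/-- The hypersurface `F = 0` in `ℙ^{n-1}` is smooth: at none of its points do all partial
derivatives of `F` vanish. -/
def IsSmoothHypersurface {n : ℕ} (F : MvPolynomial (Fin n) ℂ) : Prop :=
  ∀ y : Fin n → ℂ, y ≠ 0 → eval y F = 0 → ∃ i, eval y (pderiv i F) ≠ 0

/-- The Veronese map `ℙ(S_1) → ℙ(S_m)`, `ℓ ↦ ℓ^m`. -/
noncomputable def veroneseMap (n m : ℕ) : ℙ ℂ (Forms n 1) → ℙ ℂ (Forms n m) :=
  Projectivization.lift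
    (fun l => Projectivization.mk ℂ
      (⟨l.1.1 ^ m, by
        have h1 : (l.1.1 : S n).IsHomogeneous 1 := l.1.2
        simpa using h1.pow m⟩ : Forms n m)
      (fun h => pow_ne_zero m (fun h0 => l.2 (Subtype.ext h0)) (congrArg Subtype.val h)))
    (by
      intro a b t h
      have hc : (a.1.1 : S n) = t • b.1.1 := congrArg Subtype.val h
      refine (Projectivization.mk_eq_mk_iff' ℂ _ _ _ _).2 ⟨t ^ m, Subtype.ext ?_⟩
      simp [hc, smul_pow])

/-- The Veronese variety `V_n^m ⊆ ℙ(S_m)`, the image of the Veronese map. -/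
def veroneseVariety (n m : ℕ) : Set (ℙ ℂ (Forms n m)) := Set.range (veroneseMap n m)

/-- The degree `m` part `I_m` of an ideal `I`, as a subspace of `S_m`. -/
noncomputable def gradedPart {n : ℕ} (I : Ideal (S n)) (m : ℕ) : Submodule ℂ (Forms n m) :=
  (I.restrictScalars ℂ).comap (Forms n m).subtype

/-- The linear subspace `ℙ(W) ⊆ ℙ(V)` of a vector subspace `W ⊆ V`. -/
def projSubspace {V : Type*} [AddCommGroup V] [Module ℂ V] (W : Submodule ℂ V) : Set (ℙ ℂ V) :=
  {p | p.submodule ≤ W}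

/-- `ℙ(J(f)_{T-1}) ∩ V_n^{T-1} = ∅` in `ℙ(S_{T-1})`. -/
def MissesVeronese {n : ℕ} (d : Fin n → ℕ) (f : Fin n → S n) : Prop :=
  projSubspace (gradedPart (J f) (socleDegree d - 1)) ∩ veroneseVariety n (socleDegree d - 1) = ∅

/-- The coordinates of the affine space `S_{d_1} × ⋯ × S_{d_n}`: pairs of an index `j` and an
exponent of degree `d_j`. -/
abbrev CoeffIndex {n : ℕ} (d : Fin n → ℕ) : Type :=
  Σ j : Fin n, {a : Fin n →₀ ℕ // a.degree = d j}

/-- `P` holds for a generic tuple of forms of degrees `d_1, …, d_n`: it holds on a nonempty Zariski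
open subset of the affine space `S_{d_1} × ⋯ × S_{d_n}`, which may be taken to be the
nonvanishing locus of one nonzero polynomial `Φ` in the coefficients of the forms. -/
def HoldsGenerically {n : ℕ} (d : Fin n → ℕ) (P : (Fin n → S n) → Prop) : Prop :=
  ∃ Φ : MvPolynomial (CoeffIndex d) ℂ, Φ ≠ 0 ∧
    ∀ f : Fin n → S n, (∀ j, (f j).IsHomogeneous (d j)) →
      eval (fun a : CoeffIndex d => coeff a.2.1 (f a.1)) Φ ≠ 0 → P f

end CompleteIntersection

/-!
Write `ℓ_y = y_1 x_1 + ⋯ + y_n x_n`, and let `L` be a linear functional on `S` that vanishes on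
`J(f)` and takes the value `1` on `Jac(f)` (`IsResidue`), so that `A_f(y) = L(ℓ_y ^ T)`.

**The socle.** That `Soc(M(f))` is the line spanned by the class of `Jac(f)` is proved without
regular sequences or resolutions. If `f = A x`, then `det A ∉ J(f)` (`det_notMem_J`): write
`x_i ^ (N + 1) = ∑ b_ij f_j`, and compare `det (B A)` with `∏ x_i ^ N` modulo the powers of the
variables. By Euler's identity this applies to the Jacobian matrix, so `Jac(f) ∉ J(f)`. It also
applies to the matrix obtained at `y = 0` from `f_i(x) - f_i(y) = ∑ a_ij(x, y) (x_j - y_j)`, and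
this makes contraction with the Bezoutian `det (a_ij) ∈ M(f) ⊗ M(f)` an injective, hence bijective,
map from the dual of `M(f)` to `M(f)` that commutes with multiplication. The socle of the dual is
the line spanned by the value at the origin, so the socle of `M(f)` is a line as well
(`exists_annihilated_eq_smul`). As `Jac(f)` is a form of degree `T`, the socle lives in degree `T`,
and all forms of degree `T + 1` lie in `J(f)`.

**The equivalence.** The partial derivative `∂A_f/∂y_i` at `y` is `T L(x_i ℓ_y ^ (T - 1))`. All of
these vanish if and only if `x_i ℓ_y ^ (T - 1) ∈ J(f)` for all `i`, that is, `ℓ_y ^ (T - 1)` is in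
the socle, that is, `ℓ_y ^ (T - 1) ∈ J(f)`, since the socle is zero in degree `T - 1`
(`isSmoothHypersurface_powerForm_iff`).

**Generic smoothness.** Being a complete intersection and having a smooth associated form are open
conditions. Both come from the fact that a spanning condition persists where one minor does not
vanish (`exists_generic_reduction`); the same fact shows that the coefficients of `A_f` are rational
functions of `f`. So one example suffices. Let the forms `f_2, …, f_n` cut out a grid of points
`p = (1, a)`, and let `f_1` take the nonzero values `u (u - 1) + t` on it, where `u` is the sum of
the coordinates of `a`. A global residue computes the associated form up to a factor as
`∑ w_p t / (u (u - 1) + t) * (p ⬝ y) ^ T`, with the weights `w_p` of a finite difference operator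
(`gridFunctional_eq_zero`). For `t → 0` only the `n` linearly independent points with
`u ∈ {0, 1}` survive, and the limit is a Fermat form, which is smooth; so the form is smooth for
small `t > 0`.
-/

open MvPolynomial
open scoped LinearAlgebra.Projectivization TensorProduct

namespace CompleteIntersection

/-! ### Ideals of forms whose only common zero is the origin -/

theorem homogeneousComponent_mem_span {σ ι K : Type*} [CommRing K]
    {g : ι → MvPolynomial σ K} {e : ι → ℕ} (hg : ∀ j, (g j).IsHomogeneous (e j))
    {p : MvPolynomial σ K} (hp : p ∈ Ideal.span (Set.range g)) (N : ℕ) :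
    homogeneousComponent N p ∈ Ideal.span (Set.range g) := by
  let _ := gradedAlgebra (σ := σ) (R := K)
  refine homogeneousComponent_mem_of_mem (Ideal.homogeneous_span _ _ ?_) hp N
  rintro _ ⟨j, rfl⟩
  exact ⟨e j, hg j⟩

theorem mem_pow_idealOfVars_of_isHomogeneous {σ K : Type*} [CommRing K] {p : MvPolynomial σ K}
    {N k : ℕ} (hp : p.IsHomogeneous k) (h : N ≤ k) : p ∈ idealOfVars σ K ^ N := by
  rw [mem_pow_idealOfVars_iff']
  intro x hx
  exact hp.coeff_eq_zero (by omega)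

theorem mem_idealOfVars_of_isHomogeneous {σ K : Type*} [CommRing K] {p : MvPolynomial σ K}
    {k : ℕ} (hp : p.IsHomogeneous k) (h : 1 ≤ k) : p ∈ idealOfVars σ K := by
  simpa using mem_pow_idealOfVars_of_isHomogeneous hp h

theorem pow_idealOfVars_le_of_monomial_mem {σ K : Type*} [CommRing K]
    {I : Ideal (MvPolynomial σ K)} {N : ℕ}
    (h : ∀ a : σ →₀ ℕ, a.degree = N → monomial a (1 : K) ∈ I) : idealOfVars σ K ^ N ≤ I := by
  rw [pow_idealOfVars_eq_span, Ideal.span_le]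
  rintro _ ⟨a, ha, rfl⟩
  exact h a ha

theorem idealOfVars_isMaximal (σ K : Type*) [Field K] : (idealOfVars σ K).IsMaximal := by
  have h : idealOfVars σ K = RingHom.ker (constantCoeff (σ := σ) (R := K)) := by
    ext p
    rw [← pow_one (idealOfVars σ K), mem_pow_idealOfVars_iff', RingHom.mem_ker, constantCoeff_eq]
    constructor
    · intro h
      exact h 0 (by simp)
    · intro h x hx
      have : x = 0 := (Finsupp.degree_eq_zero_iff x).1 (by omega)
      rw [this, h]
  rw [h]
  exact RingHom.ker_isMaximal_of_surjective _ fun c => ⟨C c, by simp⟩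

/-- The Nullstellensatz for a system whose only zero is the origin. -/
theorem exists_pow_idealOfVars_le {n : ℕ} {I : Ideal (S n)}
    (h : ∀ y : Fin n → ℂ, (∀ p ∈ I, eval y p = 0) → y = 0) :
    ∃ N, idealOfVars (Fin n) ℂ ^ N ≤ I := by
  refine Ideal.exists_pow_le_of_le_radical_of_fg ?_ (idealOfVars_fg _ _)
  rw [← vanishingIdeal_zeroLocus_eq_radical (K := ℂ), Ideal.span_le]
  rintro _ ⟨i, rfl⟩
  intro y hy
  have := h y fun p hp => by simpa [aeval_eq_eval] using hy p hp
  simp [this]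

theorem eq_zero_of_pow_idealOfVars_le {n : ℕ} {I : Ideal (S n)} {N : ℕ}
    (hN : idealOfVars (Fin n) ℂ ^ N ≤ I) {y : Fin n → ℂ} (hy : ∀ p ∈ I, eval y p = 0) : y = 0 := by
  ext i
  have := hy _ (hN (Ideal.pow_mem_pow (Ideal.subset_span (Set.mem_range_self i) :
    (X i : S n) ∈ idealOfVars (Fin n) ℂ) N))
  simp at this
  simpa using this.1

theorem IsZeroDimCI.moduleFinite {n : ℕ} {d : Fin n → ℕ} {f : Fin n → S n}
    (h : IsZeroDimCI d f) : Module.Finite ℂ (M f) := by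
  have : Nontrivial (M f) := by
    by_contra hM
    rw [not_nontrivial_iff_subsingleton] at hM
    have := h.dim_zero
    rw [ringKrullDim_eq_bot_of_subsingleton] at this
    exact absurd this (by simp)
  have : Ring.KrullDimLE 0 (M f) := ringKrullDimZero_iff_ringKrullDim_eq_zero.2 h.dim_zero
  have : IsArtinianRing (M f) := isArtinianRing_iff_krullDimLE_zero.2 this
  exact Module.finite_of_isArtinianRing ℂ (M f)

/-- A tuple of forms of positive degrees is a `0`-dimensional complete intersection exactly if the
ideal it generates contains a power of the maximal ideal `(x_1, …, x_n)`. -/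
theorem isZeroDimCI_iff {n : ℕ} {d : Fin n → ℕ} (hd : ∀ j, 1 ≤ d j) {f : Fin n → S n}
    (hf : ∀ j, (f j).IsHomogeneous (d j)) :
    IsZeroDimCI d f ↔ ∃ N, idealOfVars (Fin n) ℂ ^ N ≤ J f := by
  have hJ : J f ≤ idealOfVars (Fin n) ℂ := by
    rw [J, Ideal.span_le]
    rintro _ ⟨j, rfl⟩
    exact mem_idealOfVars_of_isHomogeneous (hf j) (hd j)
  have hmax := idealOfVars_isMaximal (Fin n) ℂ
  have hne : J f ≠ ⊤ := fun h => hmax.ne_top (top_le_iff.1 (h ▸ hJ))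
  have : Nontrivial (M f) := Ideal.Quotient.nontrivial_iff.2 hne
  constructor
  · intro h
    have := h.moduleFinite
    refine Ideal.exists_pow_le_of_le_radical_of_fg ?_ (idealOfVars_fg _ _)
    rw [Ideal.span_le]
    rintro _ ⟨i, rfl⟩
    obtain ⟨P, hP, hP0⟩ := Algebra.IsIntegral.isIntegral (R := ℂ) (Ideal.Quotient.mk (J f) (X i))
    refine ⟨P.natDegree, ?_⟩
    have h1 : Polynomial.aeval (X i : S n) P ∈ J f := by
      rw [← Ideal.Quotient.eq_zero_iff_mem]
      have := (Polynomial.aeval_algHom_apply (Ideal.Quotient.mkₐ ℂ (J f)) (X i : S n) P).symm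
      exact this.trans hP0
    -- the top homogeneous component of `P(x_i)` is a power of `x_i`
    have h2 := homogeneousComponent_mem_span hf h1 P.natDegree
    have h3 : homogeneousComponent P.natDegree (Polynomial.aeval (X i : S n) P)
        = X i ^ P.natDegree := by
      rw [Polynomial.aeval_eq_sum_range, map_sum, Finset.sum_eq_single P.natDegree]
      · rw [hP.coeff_natDegree, one_smul]
        exact homogeneousComponent_eq_self (isHomogeneous_X_pow _ _)
      · intro k _ hk
        rw [map_smul, homogeneousComponent_of_mem (isHomogeneous_X_pow i k), if_neg (by omega),
          smul_zero]
      · simp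
    rwa [h3] at h2
  · rintro ⟨N, hN⟩
    refine ⟨hf, ringKrullDimZero_iff_ringKrullDim_eq_zero.1 ?_⟩
    rw [Ideal.krullDimLE_zero_quotient_iff_forall_minimalPrimes_isMaximal]
    intro P hP
    have hp : P.IsPrime := hP.1.1
    have : idealOfVars (Fin n) ℂ ≤ P := hp.le_of_pow_le (hN.trans hP.1.2)
    rwa [← hmax.eq_of_le hp.ne_top this]

/-! ### Openness of spanning conditions -/

instance finite_degree_eq (n k : ℕ) : Finite {a : Fin n →₀ ℕ // a.degree = k} :=
  ((Finsupp.finite_of_degree_le k).subset fun a (ha : a.degree = k) => ha.le).to_subtype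

/-- **Openness of a spanning condition.** Let `g_j` and `h` be families of polynomials whose
coefficients are polynomials in parameters `c`. If at `c₀` every form of degree `N` lies in
`(g_j) + ℂ h`, then after inverting one polynomial `D` in the parameters, nonzero at `c₀`, each
monomial `x^a` of degree `N` is congruent modulo `(g_j)` to a multiple of `h`, and the factor is
`ρ a / D` for a polynomial `ρ a` in the parameters. -/
theorem exists_generic_reduction {n : ℕ} {ι τ : Type*}
    (g : ι → MvPolynomial (Fin n) (MvPolynomial τ ℂ)) (h : MvPolynomial (Fin n) (MvPolynomial τ ℂ))
    (N : ℕ) (c₀ : τ → ℂ)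
    (hspan : ∀ a : Fin n →₀ ℕ, a.degree = N → ∃ t : ℂ, monomial a (1 : ℂ) - C t * map (eval c₀) h ∈
      Ideal.span (Set.range fun j => map (eval c₀) (g j))) :
    ∃ (D : MvPolynomial τ ℂ) (ρ : (Fin n →₀ ℕ) → MvPolynomial τ ℂ), eval c₀ D ≠ 0 ∧
      ∀ (c : τ → ℂ) (e : ι → ℕ), (∀ j, (map (eval c) (g j)).IsHomogeneous (e j)) →
        (map (eval c) h).IsHomogeneous N → ∀ a : Fin n →₀ ℕ, a.degree = N →
          monomial a (eval c D) - C (eval c (ρ a)) * map (eval c) h ∈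
            Ideal.span (Set.range fun j => map (eval c) (g j)) := by
  classical
  set A := {a : Fin n →₀ ℕ // a.degree = N}
  have := Fintype.ofFinite A
  -- the generators of the vector space `(g_j) + ℂ h`, and their coefficients in degree `N`
  let G : Option (ι × (Fin n →₀ ℕ)) → MvPolynomial (Fin n) (MvPolynomial τ ℂ) :=
    fun k => k.elim h fun q => monomial q.2 1 * g q.1
  let w : Option (ι × (Fin n →₀ ℕ)) → A → ℂ := fun k a => coeff a.1 (map (eval c₀) (G k))
  let π : S n →ₗ[ℂ] (A → ℂ) := LinearMap.pi fun a => lcoeff ℂ a.1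
  have hmem : ∀ p ∈ Ideal.span (Set.range fun j => map (eval c₀) (g j)), ∀ q : S n,
      π (q * p) ∈ Submodule.span ℂ (Set.range w) := by
    intro p hp
    induction hp using Submodule.span_induction with
    | mem p hp =>
      obtain ⟨j, rfl⟩ := hp
      intro q
      induction q using MvPolynomial.induction_on' with
      | monomial b r =>
        have : π (monomial b r * map (eval c₀) (g j)) = r • w (some (j, b)) := by
          ext a
          have hr : (monomial b r : S n) = C r * monomial b 1 := by simp [C_mul_monomial]
          simp only [π, w, G, LinearMap.pi_apply, lcoeff_apply, hr, mul_assoc, coeff_C_mul,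
            Option.elim, map_mul, map_monomial, map_one, Pi.smul_apply, smul_eq_mul]
        rw [this]
        exact Submodule.smul_mem _ _ (Submodule.subset_span ⟨_, rfl⟩)
      | add p q hp hq => rw [add_mul, map_add]; exact Submodule.add_mem _ hp hq
    | zero => simp
    | add p q _ _ hp hq => intro r; rw [mul_add, map_add]; exact Submodule.add_mem _ (hp r) (hq r)
    | smul r p _ hp => intro q; rw [smul_eq_mul, ← mul_assoc]; exact hp _
  have htop : Submodule.span ℂ (Set.range w) = ⊤ := by
    rw [eq_top_iff]
    intro x _
    rw [pi_eq_sum_univ x]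
    refine Submodule.sum_mem _ fun a _ => Submodule.smul_mem _ _ ?_
    obtain ⟨t, ht⟩ := hspan a.1 a.2
    have h1 := hmem _ ht 1
    have h2 : (fun b => if a = b then (1 : ℂ) else 0)
        = π (1 * (monomial a.1 (1 : ℂ) - C t * map (eval c₀) h)) + t • w none := by
      ext b
      simpa [π, w, G, coeff_monomial] using if_congr Subtype.ext_iff rfl rfl
    rw [h2]
    exact Submodule.add_mem _ h1 (Submodule.smul_mem _ _ (Submodule.subset_span ⟨_, rfl⟩))
  -- generators forming a basis in degree `N` at `c₀`
  obtain ⟨κ, k, -, hk, hli⟩ := exists_linearIndependent' ℂ w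
  let b := Module.Basis.mk hli (by rw [hk, htop])
  let s : A → Option (ι × (Fin n →₀ ℕ)) := k ∘ (Pi.basisFun ℂ A).indexEquiv b
  have hs : LinearIndependent ℂ (w ∘ s) := hli.comp _ (Equiv.injective _)
  let V : Matrix A A (MvPolynomial τ ℂ) := Matrix.of fun m a => coeff a.1 (G (s m))
  have hV : eval c₀ V.det ≠ 0 := by
    have h1 : V.map (eval c₀) = Matrix.of (w ∘ s) := by
      ext m a
      simp [V, w, coeff_map]
    rw [RingHom.map_det, RingHom.mapMatrix_apply, h1]
    exact ((Matrix.isUnit_iff_isUnit_det _).1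
      (Matrix.linearIndependent_rows_iff_isUnit.1 hs)).ne_zero
  refine ⟨V.det, fun a => if ha : a.degree = N then
    ∑ m, if s m = none then V.adjugate ⟨a, ha⟩ m else 0 else 0, hV, ?_⟩
  intro c e hg hh a ha
  simp only [ha, dif_pos]
  set I := Ideal.span (Set.range fun j => map (eval c) (g j)) with hI
  -- Cramer's rule for `V` writes `D x^a` through the chosen generators, up to terms of other
  -- degrees; these disappear on passing to the component of degree `N`, as `(g_j)` is homogeneous
  have key : (∑ m, C (eval c (V.adjugate ⟨a, ha⟩ m)) * map (eval c) (G (s m)))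
      - C (eval c (∑ m, if s m = none then V.adjugate ⟨a, ha⟩ m else 0)) * map (eval c) h ∈ I := by
    rw [map_sum, map_sum, Finset.sum_mul, ← Finset.sum_sub_distrib]
    refine Ideal.sum_mem _ fun m _ => ?_
    rcases hm : s m with _ | ⟨j, x⟩
    · simp [G]
    · simp only [G, Option.elim, map_mul, reduceCtorEq, if_false, map_zero, zero_mul, sub_zero]
      exact Ideal.mul_mem_left _ _ (Ideal.mul_mem_left _ _ (Ideal.subset_span ⟨j, rfl⟩))
  have key2 := homogeneousComponent_mem_span hg key N
  rw [map_sub, homogeneousComponent_C_mul, homogeneousComponent_eq_self hh] at key2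
  convert key2 using 2
  ext x
  rw [coeff_homogeneousComponent, coeff_monomial]
  split_ifs with h1 h2 h2
  · subst h1
    have := congrFun (congrFun V.adjugate_mul ⟨a, ha⟩) ⟨a, ha⟩
    rw [Matrix.mul_apply] at this
    simp only [Matrix.smul_apply, Matrix.one_apply_eq, smul_eq_mul, mul_one] at this
    rw [← this]
    simp [coeff_sum, coeff_C_mul, coeff_map, V]
  · exact absurd (h1 ▸ ha) h2
  · have := congrFun (congrFun V.adjugate_mul ⟨a, ha⟩) ⟨x, h2⟩
    rw [Matrix.mul_apply, Matrix.smul_apply, Matrix.one_apply_ne (by simpa using h1), smul_zero]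
      at this
    rw [← map_zero (eval c), ← this]
    simp [coeff_sum, coeff_C_mul, coeff_map, V]
  · rfl

/-! ### Power forms and smoothness in families -/

/-- Containing a power of the maximal ideal `(x)` is an open condition on the parameters of a family
of ideals generated by forms. -/
theorem exists_generic_pow_le {n : ℕ} {ι τ : Type*}
    {g : ι → MvPolynomial (Fin n) (MvPolynomial τ ℂ)} {e : ι → ℕ}
    (hg : ∀ j, (g j).IsHomogeneous (e j)) {N : ℕ} {c₀ : τ → ℂ}
    (h₀ : idealOfVars (Fin n) ℂ ^ N ≤ Ideal.span (Set.range fun j => map (eval c₀) (g j))) :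
    ∃ D : MvPolynomial τ ℂ, eval c₀ D ≠ 0 ∧ ∀ c : τ → ℂ, eval c D ≠ 0 →
      idealOfVars (Fin n) ℂ ^ N ≤ Ideal.span (Set.range fun j => map (eval c) (g j)) := by
  obtain ⟨D, ρ, hD, h⟩ := exists_generic_reduction g 0 N c₀ fun a ha =>
    ⟨0, by simpa using h₀ ((monomial_mem_pow_idealOfVars_iff N a one_ne_zero).2 ha.ge)⟩
  refine ⟨D, hD, fun c hc => pow_idealOfVars_le_of_monomial_mem fun a ha => ?_⟩
  have h1 := h c e (fun j => (hg j).map _) (by simpa using isHomogeneous_zero _ _ _) a ha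
  have h2 : (monomial a (1 : ℂ)) = C (eval c D)⁻¹ * monomial a (eval c D) := by
    rw [C_mul_monomial, inv_mul_cancel₀ hc]
  rw [h2]
  exact Ideal.mul_mem_left _ _ (by simpa using h1)

/-- By Euler's identity, common zeros of the partial derivatives lie on the hypersurface. -/
theorem isSmoothHypersurface_iff {n m : ℕ} (hm : m ≠ 0) {F : MvPolynomial (Fin n) ℂ}
    (hF : F.IsHomogeneous m) :
    IsSmoothHypersurface F ↔ ∀ y : Fin n → ℂ, (∀ i, eval y (pderiv i F) = 0) → y = 0 := by
  constructor
  · intro h y hy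
    by_contra hne
    obtain ⟨i, hi⟩ := h y hne (by
      have := congrArg (eval y) hF.sum_X_mul_pderiv
      simpa [map_sum, hy, hm] using this.symm)
    exact hi (hy i)
  · intro h y hne _
    by_contra! hy
    exact hne (h y hy)

theorem IsSmoothHypersurface.of_C_mul {n : ℕ} {t : ℂ} {F : MvPolynomial (Fin n) ℂ}
    (h : IsSmoothHypersurface (C t * F)) : IsSmoothHypersurface F := by
  intro y hy h0
  obtain ⟨i, hi⟩ := h y hy (by simp [h0])
  exact ⟨i, fun h1 => hi (by simp [h1])⟩

theorem IsSmoothHypersurface.C_mul {n : ℕ} {t : ℂ} (ht : t ≠ 0) {F : MvPolynomial (Fin n) ℂ}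
    (h : IsSmoothHypersurface F) : IsSmoothHypersurface (C t * F) := by
  intro y hy h0
  obtain ⟨i, hi⟩ := h y hy (by simpa [ht] using h0)
  exact ⟨i, by simpa [pderiv_C_mul, ht] using hi⟩

/-- Smoothness is an open condition on the parameters of a family of forms. -/
theorem exists_generic_isSmoothHypersurface {n m : ℕ} {τ : Type*} (hm : m ≠ 0)
    {F : MvPolynomial (Fin n) (MvPolynomial τ ℂ)} (hF : F.IsHomogeneous m) {c₀ : τ → ℂ}
    (h₀ : IsSmoothHypersurface (map (eval c₀) F)) :
    ∃ D : MvPolynomial τ ℂ, eval c₀ D ≠ 0 ∧ ∀ c : τ → ℂ, eval c D ≠ 0 →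
      IsSmoothHypersurface (map (eval c) F) := by
  obtain ⟨N, hN⟩ := exists_pow_idealOfVars_le
    (I := Ideal.span (Set.range fun i => map (eval c₀) (pderiv i F))) fun y hy =>
      (isSmoothHypersurface_iff hm (hF.map _)).1 h₀ y fun i => by
        rw [pderiv_map]
        exact hy _ (Ideal.subset_span ⟨i, rfl⟩)
  obtain ⟨D, hD, h⟩ := exists_generic_pow_le (fun i => hF.pderiv (i := i)) hN
  refine ⟨D, hD, fun c hc => (isSmoothHypersurface_iff hm (hF.map _)).2 fun y hy => ?_⟩
  refine eq_zero_of_pow_idealOfVars_le (h c hc) fun p hp => ?_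
  have : Ideal.span (Set.range fun i => map (eval c) (pderiv i F)) ≤ RingHom.ker (eval y) := by
    rw [Ideal.span_le]
    rintro _ ⟨i, rfl⟩
    simpa [pderiv_map] using hy i
  exact this hp

/-- For a linear functional `φ` on polynomials, the form `y ↦ φ ((y_1 x_1 + ⋯ + y_n x_n) ^ m)` of
degree `m`. The recursion on `m` splits off one factor of the power. -/
noncomputable def powerForm {n : ℕ} {k : Type*} [CommRing k] :
    ℕ → (MvPolynomial (Fin n) k →ₗ[k] k) → MvPolynomial (Fin n) k
  | 0, φ => C (φ 1)
  | m + 1, φ => ∑ i, X i * powerForm m (φ ∘ₗ LinearMap.mulLeft k (X i))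

section powerForm

variable {n : ℕ} {k : Type*} [CommRing k]

theorem eval_powerForm (m : ℕ) (φ : MvPolynomial (Fin n) k →ₗ[k] k) (y : Fin n → k) :
    eval y (powerForm m φ) = φ ((∑ i, C (y i) * X i) ^ m) := by
  induction m generalizing φ with
  | zero => simp [powerForm]
  | succ m ih =>
    simp only [powerForm, map_sum, map_mul, eval_X, ih, LinearMap.comp_apply,
      LinearMap.mulLeft_apply, pow_succ', Finset.sum_mul, C_mul', map_smul,
      smul_mul_assoc, smul_eq_mul]

theorem isHomogeneous_powerForm (m : ℕ) (φ : MvPolynomial (Fin n) k →ₗ[k] k) :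
    (powerForm m φ).IsHomogeneous m := by
  induction m generalizing φ with
  | zero => exact isHomogeneous_C _ _
  | succ m ih =>
    refine IsHomogeneous.sum _ _ _ fun i _ => ?_
    rw [add_comm]
    exact (isHomogeneous_X _ _).mul (ih _)

theorem pderiv_powerForm (m : ℕ) (φ : MvPolynomial (Fin n) k →ₗ[k] k) (i : Fin n) :
    pderiv i (powerForm (m + 1) φ)
      = C ((m : k) + 1) * powerForm m (φ ∘ₗ LinearMap.mulLeft k (X i)) := by
  classical
  induction m generalizing φ with
  | zero => simp [powerForm, pderiv_X, Pi.single_apply]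
  | succ m ih =>
    have h (j : Fin n) : (φ ∘ₗ LinearMap.mulLeft k (X j)) ∘ₗ LinearMap.mulLeft k (X i)
        = (φ ∘ₗ LinearMap.mulLeft k (X i)) ∘ₗ LinearMap.mulLeft k (X j) := by
      exact LinearMap.ext fun p => by simp [mul_left_comm]
    rw [powerForm, map_sum]
    simp only [Derivation.leibniz, ih, pderiv_X, smul_eq_mul, Finset.sum_add_distrib, h]
    have h2 : ∑ j : Fin n, X j * (C ((m : k) + 1) *
        powerForm m ((φ ∘ₗ LinearMap.mulLeft k (X i)) ∘ₗ LinearMap.mulLeft k (X j)))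
        = C ((m : k) + 1) * powerForm (m + 1) (φ ∘ₗ LinearMap.mulLeft k (X i)) := by
      rw [powerForm, Finset.mul_sum]
      exact Finset.sum_congr rfl fun j _ => by ring
    rw [h2]
    simp [Pi.single_apply]
    ring

theorem map_powerForm {k' : Type*} [CommRing k'] (r : k →+* k') (m : ℕ)
    (φ : MvPolynomial (Fin n) k →ₗ[k] k) (φ' : MvPolynomial (Fin n) k' →ₗ[k'] k')
    (h : ∀ p, φ' (map r p) = r (φ p)) : map r (powerForm m φ) = powerForm m φ' := by
  induction m generalizing φ φ' with
  | zero => simp [powerForm, ← h]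
  | succ m ih =>
    simp only [powerForm, map_sum, map_mul, map_X]
    exact Finset.sum_congr rfl fun i _ => by
      rw [ih _ (φ' ∘ₗ LinearMap.mulLeft k' (X i)) (by simp [← h])]

end powerForm

/-! ### Determinants of transition matrices -/

/-- Cramer's rule. -/
theorem adjugate_mulVec_mulVec_apply {R ι : Type*} [CommRing R] [Fintype ι] [DecidableEq ι]
    (B : Matrix ι ι R) (v : ι → R) (j : ι) :
    B.adjugate.mulVec (B.mulVec v) j = B.det * v j := by
  rw [Matrix.mulVec_mulVec, Matrix.adjugate_mul, Matrix.smul_mulVec, Matrix.one_mulVec,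
    Pi.smul_apply, smul_eq_mul]

section PowersOfVariables

variable {σ K : Type*} [CommRing K]

theorem mem_span_X_pow_iff (s : Set σ) (N : ℕ) (p : MvPolynomial σ K) :
    p ∈ Ideal.span ((fun k => (X k : MvPolynomial σ K) ^ N) '' s) ↔
      ∀ a ∈ p.support, ∃ k ∈ s, N ≤ a k := by
  have h : (fun k => (X k : MvPolynomial σ K) ^ N) '' s
      = (fun a => monomial a (1 : K)) '' ((fun k => Finsupp.single k N) '' s) := by
    rw [Set.image_image]
    exact Set.image_congr fun k _ => by rw [X_pow_eq_monomial]
  rw [h, mem_ideal_span_monomial_image]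
  simp

variable [Fintype σ] [DecidableEq σ]

/-- By Cramer's rule `x_i det B` lies in the ideal of the powers of the variables other than `x_i`,
and `x_i` is a nonzerodivisor modulo that ideal. -/
theorem det_mem_span_X_pow_of_row {N : ℕ} {B : Matrix σ σ (MvPolynomial σ K)} {i : σ}
    (hi : ∑ j, B i j * X j = 0) (hB : ∀ k, k ≠ i → ∑ j, B k j * X j = X k ^ N) :
    B.det ∈ Ideal.span (Set.range fun k => (X k : MvPolynomial σ K) ^ N) := by
  have h1 : X i * B.det ∈
      Ideal.span ((fun k => (X k : MvPolynomial σ K) ^ N) '' {k | k ≠ i}) := by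
    rw [mul_comm, ← adjugate_mulVec_mulVec_apply B X i]
    refine Ideal.sum_mem _ fun k _ => Ideal.mul_mem_left _ _ ?_
    by_cases hk : k = i
    · subst hk
      simp [Matrix.mulVec, dotProduct, hi]
    · exact Ideal.subset_span ⟨k, hk, by simp [Matrix.mulVec, dotProduct, hB k hk]⟩
  rw [mem_span_X_pow_iff] at h1
  rw [← Set.image_univ, mem_span_X_pow_iff]
  intro a ha
  obtain ⟨k, hk, h⟩ := h1 (Finsupp.single i 1 + a) (by
    rw [mem_support_iff, coeff_X_mul]
    exact mem_support_iff.1 ha)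
  refine ⟨k, trivial, ?_⟩
  rwa [Finsupp.add_apply, Finsupp.single_eq_of_ne hk, zero_add] at h

/-- If the matrix `A` expresses the powers `x_i ^ (N + 1)` through the variables, then `det A` is
congruent to `∏ x_i ^ N`, the determinant of the diagonal choice of `A`. -/
theorem det_sub_prod_mem_span_X_pow {N : ℕ} {A : Matrix σ σ (MvPolynomial σ K)}
    (hA : ∀ i, ∑ j, A i j * X j = X i ^ (N + 1)) :
    A.det - ∏ i, X i ^ N ∈ Ideal.span (Set.range fun k => (X k : MvPolynomial σ K) ^ (N + 1)) := by
  let D : Matrix σ σ (MvPolynomial σ K) := Matrix.diagonal fun i => X i ^ N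
  have hD (i : σ) : ∑ j, D i j * X j = X i ^ (N + 1) := by
    simp [D, Matrix.diagonal_apply, pow_succ]
  -- pass from the rows of `D` to the rows of `A` one at a time
  have key (s : Finset σ) : (Matrix.of fun i => if i ∈ s then A i else D i).det - D.det ∈
      Ideal.span (Set.range fun k => (X k : MvPolynomial σ K) ^ (N + 1)) := by
    induction s using Finset.induction_on with
    | empty =>
      have : (Matrix.of fun i => if i ∈ (∅ : Finset σ) then A i else D i) = D := by
        ext i j; simp
      rw [this, sub_self]
      exact Ideal.zero_mem _
    | insert i s hi ih =>
      set B : Matrix σ σ (MvPolynomial σ K) := Matrix.of fun k => if k ∈ s then A k else D k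
      have h1 : (Matrix.of fun k => if k ∈ insert i s then A k else D k) = B.updateRow i (A i) := by
        ext k j
        by_cases hk : k = i
        · subst hk; simp
        · simp [hk, B]
      have h2 : B.det = (B.updateRow i (D i)).det := by
        congr 1
        ext k j
        by_cases hk : k = i
        · subst hk; simp [B, hi]
        · simp [hk]
      have h3 : (B.updateRow i (A i)).det = (B.updateRow i (A i - D i)).det + B.det := by
        rw [h2, ← Matrix.det_updateRow_add, sub_add_cancel]
      -- the new row `A i - D i` is a relation between the variables
      rw [h1, h3, add_sub_assoc]
      refine Ideal.add_mem _ (det_mem_span_X_pow_of_row (i := i) ?_ ?_) ih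
      · simp [sub_mul, hA, hD]
      · intro k hk
        simp only [Matrix.updateRow_ne hk]
        by_cases hks : k ∈ s
        · simp [B, hks, hA]
        · simp [B, hks, hD]
  have h := key Finset.univ
  simp only [Finset.mem_univ, if_true, D, Matrix.det_diagonal] at h
  exact h

theorem det_notMem_span_X_pow [Nontrivial K] {N : ℕ} {A : Matrix σ σ (MvPolynomial σ K)}
    (hA : ∀ i, ∑ j, A i j * X j = X i ^ (N + 1)) :
    A.det ∉ Ideal.span (Set.range fun k => (X k : MvPolynomial σ K) ^ (N + 1)) := by
  intro h
  have h1 := Ideal.sub_mem _ h (det_sub_prod_mem_span_X_pow hA)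
  rw [sub_sub_cancel, ← Set.image_univ, mem_span_X_pow_iff] at h1
  have h2 : ∏ i, (X i : MvPolynomial σ K) ^ N
      = monomial (Finsupp.equivFunOnFinite.symm fun _ => N) 1 := by
    rw [monomial_eq, C_1, one_mul, Finsupp.prod_fintype _ _ (by simp)]
    simp
  rw [h2] at h1
  obtain ⟨k, -, hk⟩ := h1 (Finsupp.equivFunOnFinite.symm fun _ => N) (by simp)
  simp at hk

end PowersOfVariables

/-- If `f = A x` and the ideal `(f)` contains a power of the maximal ideal `(x)`, then
`det A ∉ (f)`: with `x ^ (N + 1) = B f`, multiplication by `det B` maps `(f)` into the ideal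
`(x ^ (N + 1))`, which does not contain `det (B A)`. -/
theorem det_notMem_J {n N : ℕ} {f : Fin n → S n} (hN : idealOfVars (Fin n) ℂ ^ N ≤ J f)
    {A : Matrix (Fin n) (Fin n) (S n)} (hA : ∀ i, ∑ j, A i j * X j = f i) : A.det ∉ J f := by
  intro h
  have hX (i : Fin n) : ∃ b : Fin n → S n, ∑ j, b j * f j = X i ^ (N + 1) := by
    have : (X i : S n) ^ (N + 1) ∈ J f := hN (Ideal.pow_le_pow_right (Nat.le_succ N)
      (Ideal.pow_mem_pow (Ideal.subset_span (Set.mem_range_self i)) _))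
    exact Ideal.mem_span_range_iff_exists_fun.1 this
  choose b hb using hX
  let B : Matrix (Fin n) (Fin n) (S n) := Matrix.of b
  have hBf (i : Fin n) : B.mulVec f i = X i ^ (N + 1) := by
    simpa [B, Matrix.mulVec, dotProduct] using hb i
  have hBA (i : Fin n) : ∑ j, (B * A) i j * X j = X i ^ (N + 1) := by
    have : A.mulVec X = f := funext fun i => by simpa [Matrix.mulVec, dotProduct] using hA i
    have := hBf i
    rw [← ‹A.mulVec X = f›, Matrix.mulVec_mulVec] at this
    simpa [Matrix.mulVec, dotProduct] using this
  refine det_notMem_span_X_pow hBA ?_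
  rw [Matrix.det_mul]
  have h1 : J f ≤ Submodule.comap (LinearMap.mulLeft (S n) B.det)
      (Ideal.span (Set.range fun k => (X k : S n) ^ (N + 1))) := by
    rw [J, Ideal.span, Submodule.span_le]
    rintro _ ⟨j, rfl⟩
    show B.det * f j ∈ Ideal.span (Set.range fun k => (X k : S n) ^ (N + 1))
    rw [← adjugate_mulVec_mulVec_apply, Matrix.mulVec, dotProduct]
    refine Ideal.sum_mem _ fun k _ => ?_
    rw [hBf]
    refine Ideal.mul_mem_left _ _ ?_
    exact Ideal.subset_span (Set.mem_range_self k)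
  exact h1 h

/-! ### The Bezoutian and the socle -/

/-- Contraction of the second factor of `M ⊗ M` with a linear functional. -/
noncomputable def contract {M : Type*} [CommRing M] [Algebra ℂ M] (φ : M →ₗ[ℂ] ℂ) :
    M ⊗[ℂ] M →ₗ[ℂ] M :=
  (TensorProduct.rid ℂ M).toLinearMap ∘ₗ LinearMap.lTensor M φ

section contract

variable {M : Type*} [CommRing M] [Algebra ℂ M]

@[simp]
theorem contract_tmul (φ : M →ₗ[ℂ] ℂ) (x y : M) : contract φ (x ⊗ₜ y) = φ y • x := by
  simp [contract]

theorem contract_tmul_one_mul (φ : M →ₗ[ℂ] ℂ) (x : M) (z : M ⊗[ℂ] M) :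
    contract φ ((x ⊗ₜ 1) * z) = x * contract φ z := by
  induction z using TensorProduct.induction_on with
  | zero => simp
  | tmul a b => simp
  | add a b ha hb => rw [mul_add, map_add, ha, hb, map_add, mul_add]

theorem contract_one_tmul_mul (φ : M →ₗ[ℂ] ℂ) (x : M) (z : M ⊗[ℂ] M) :
    contract φ ((1 ⊗ₜ x) * z) = contract (φ ∘ₗ LinearMap.mulLeft ℂ x) z := by
  induction z using TensorProduct.induction_on with
  | zero => simp
  | tmul a b => simp
  | add a b ha hb => rw [mul_add, map_add, ha, hb, map_add]

/-- Contraction of a fixed tensor, as a linear map on the dual space. -/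
noncomputable def contractWith (β : M ⊗[ℂ] M) : (M →ₗ[ℂ] ℂ) →ₗ[ℂ] M where
  toFun φ := contract φ β
  map_add' φ ψ := by simp [contract, LinearMap.lTensor_add]
  map_smul' t φ := by simp [contract, LinearMap.lTensor_smul]

end contract

/-- `g(x) - g(y)` lies in the ideal of the diagonal, generated by the `x_j - y_j`. -/
theorem tmul_sub_tmul_mem_span {n : ℕ} (g : S n) :
    g ⊗ₜ[ℂ] (1 : S n) - (1 : S n) ⊗ₜ[ℂ] g ∈ Ideal.span (Set.range fun j : Fin n =>
      (X j : S n) ⊗ₜ[ℂ] (1 : S n) - (1 : S n) ⊗ₜ[ℂ] (X j : S n)) := by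
  induction g using MvPolynomial.induction_on with
  | C c =>
    have : (C c : S n) = c • 1 := by rw [smul_eq_C_mul, mul_one]
    rw [this, TensorProduct.smul_tmul, sub_self]
    exact Ideal.zero_mem _
  | add p q hp hq =>
    rw [TensorProduct.add_tmul, TensorProduct.tmul_add, add_sub_add_comm]
    exact Ideal.add_mem _ hp hq
  | mul_X p i hp =>
    have h : (p * X i) ⊗ₜ[ℂ] (1 : S n) - (1 : S n) ⊗ₜ[ℂ] (p * X i)
        = (X i ⊗ₜ[ℂ] (1 : S n)) * (p ⊗ₜ[ℂ] (1 : S n) - (1 : S n) ⊗ₜ[ℂ] p)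
          + ((1 : S n) ⊗ₜ[ℂ] p) * (X i ⊗ₜ[ℂ] (1 : S n) - (1 : S n) ⊗ₜ[ℂ] X i) := by
      simp only [mul_sub, Algebra.TensorProduct.tmul_mul_tmul, one_mul, mul_one, mul_comm (X i) p]
      ring
    rw [h]
    exact Ideal.add_mem _ (Ideal.mul_mem_left _ _ hp)
      (Ideal.mul_mem_left _ _ (Ideal.subset_span ⟨i, rfl⟩))

/-- The value at the origin as a functional on `M(f)`. -/
noncomputable def evalZero {n : ℕ} (f : Fin n → S n) (hf : ∀ i, constantCoeff (f i) = 0) :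
    M f →ₐ[ℂ] ℂ :=
  Ideal.Quotient.liftₐ (J f) (aeval (0 : Fin n → ℂ)) fun p hp => by
    have : J f ≤ RingHom.ker (aeval (0 : Fin n → ℂ) : S n →ₐ[ℂ] ℂ) := by
      rw [J, Ideal.span_le]
      rintro _ ⟨i, rfl⟩
      simpa [aeval_zero] using hf i
    exact this hp

@[simp]
theorem evalZero_mk {n : ℕ} (f : Fin n → S n) (hf : ∀ i, constantCoeff (f i) = 0) (p : S n) :
    evalZero f hf (Ideal.Quotient.mk (J f) p) = constantCoeff p := by
  have : evalZero f hf (Ideal.Quotient.mk (J f) p) = aeval (0 : Fin n → ℂ) p :=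
    Ideal.Quotient.liftₐ_apply _ _ _ _
  simpa [aeval_zero] using this

section Bezoutian

variable {n N : ℕ} {f : Fin n → S n} {R : Type*} [CommRing R] [Algebra ℂ R] {q : S n →ₐ[ℂ] R}
  {ε : R →ₐ[ℂ] ℂ}

/-- **The Bezoutian.** Let `q : S → R` be a quotient map with kernel `(f)`. There is a tensor
`β ∈ R ⊗ R` on which the two multiplications by each `x_j` agree and whose contraction with the
value at the origin is not zero: writing `f_i(x) - f_i(y) = ∑ a_ij(x, y) (x_j - y_j)`, it is the
class of `det (a_ij)`, and setting `y = 0` gives a matrix `A` with `f = A x`. -/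
theorem exists_bezoutian (hN : idealOfVars (Fin n) ℂ ^ N ≤ J f)
    (hf : ∀ i, constantCoeff (f i) = 0) (hq : ∀ p, q p = 0 ↔ p ∈ J f)
    (hε : ∀ p, ε (q p) = constantCoeff p) :
    ∃ β : R ⊗[ℂ] R, (∀ j, (q (X j) ⊗ₜ[ℂ] (1 : R)) * β = ((1 : R) ⊗ₜ[ℂ] q (X j)) * β) ∧
      contract ε.toLinearMap β ≠ 0 := by
  have h1 (i : Fin n) := Ideal.mem_span_range_iff_exists_fun.1 (tmul_sub_tmul_mem_span (f i))
  choose a ha using h1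
  let Q : S n ⊗[ℂ] S n →ₐ[ℂ] R ⊗[ℂ] R := Algebra.TensorProduct.map q q
  -- `E` sets the second group of variables to zero
  let E : S n ⊗[ℂ] S n →ₐ[ℂ] S n := Algebra.TensorProduct.lift (AlgHom.id ℂ (S n))
    ((Algebra.ofId ℂ (S n)).comp (aeval (0 : Fin n → ℂ))) fun _ _ => Commute.all _ _
  have hE (x y : S n) : E (x ⊗ₜ y) = x * C (constantCoeff y) := by
    simp [E, Algebra.ofId_apply, MvPolynomial.algebraMap_eq]
  have hqf (i : Fin n) : q (f i) = 0 := (hq _).2 (Ideal.subset_span ⟨i, rfl⟩)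
  refine ⟨Q (Matrix.of a).det, fun j => ?_, ?_⟩
  · let B : Matrix (Fin n) (Fin n) (R ⊗[ℂ] R) := Q.mapMatrix (Matrix.of a)
    let δ : Fin n → R ⊗[ℂ] R := fun j => q (X j) ⊗ₜ[ℂ] (1 : R) - (1 : R) ⊗ₜ[ℂ] q (X j)
    -- both `f_i ⊗ 1` and `1 ⊗ f_i` vanish in `R ⊗ R`
    have hB : B.mulVec δ = 0 := by
      ext i
      have := congrArg Q (ha i)
      simpa [Q, B, δ, Matrix.mulVec, dotProduct, hqf] using this
    have h2 := adjugate_mulVec_mulVec_apply B δ j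
    rw [hB, Matrix.mulVec_zero, Pi.zero_apply, ← AlgHom.map_det, mul_comm] at h2
    rw [← sub_eq_zero, ← sub_mul]
    exact h2.symm
  · have h2 (z : S n ⊗[ℂ] S n) : contract ε.toLinearMap (Q z) = q (E z) := by
      induction z using TensorProduct.induction_on with
      | zero => simp
      | tmul x y => simp [Q, hE, hε, mul_comm x, C_mul']
      | add x y hx hy => simp only [map_add, hx, hy]
    rw [h2, Ne, hq, AlgHom.map_det]
    refine det_notMem_J hN fun i => ?_
    have := congrArg E (ha i)
    simpa [hE, hf] using this

/-- The socle of `S / (f)` has dimension at most one: contraction with the Bezoutian is an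
isomorphism from the dual space of `S / (f)` to `S / (f)` that commutes with multiplication, and
the functionals killed by all `x_j` are the multiples of the value at the origin. The contraction
is injective since its kernel, a submodule, would otherwise contain the value at the origin. -/
theorem exists_annihilated_eq_smul [Module.Finite ℂ R] (hN : idealOfVars (Fin n) ℂ ^ N ≤ J f)
    (hf : ∀ i, constantCoeff (f i) = 0) (hq : ∀ p, q p = 0 ↔ p ∈ J f)
    (hq' : Function.Surjective q) (hε : ∀ p, ε (q p) = constantCoeff p) :
    ∃ t : R, ∀ s : R, (∀ j, q (X j) * s = 0) → ∃ c : ℂ, s = c • t := by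
  obtain ⟨β, hβ, hβ0⟩ := exists_bezoutian hN hf hq hε
  have hmul (j : Fin n) (φ : R →ₗ[ℂ] ℂ) :
      contractWith β (φ ∘ₗ LinearMap.mulLeft ℂ (q (X j))) = q (X j) * contractWith β φ := by
    show contract _ β = q (X j) * contract φ β
    rw [← contract_one_tmul_mul, ← hβ, contract_tmul_one_mul]
  have hann (φ : R →ₗ[ℂ] ℂ) (hφ : ∀ j, φ ∘ₗ LinearMap.mulLeft ℂ (q (X j)) = 0) :
      φ = φ 1 • ε.toLinearMap := by
    ext m
    obtain ⟨p, rfl⟩ := hq' m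
    induction p using MvPolynomial.induction_on with
    | C c =>
      have : q (C c) = c • 1 := by
        rw [Algebra.smul_def, mul_one, ← MvPolynomial.algebraMap_eq, AlgHom.commutes]
      simp [this, mul_comm]
    | add p q hp hq => rw [map_add, map_add, map_add, hp, hq]
    | mul_X p i _ =>
      have := LinearMap.congr_fun (hφ i) (q p)
      rw [LinearMap.comp_apply, LinearMap.mulLeft_apply, ← map_mul, mul_comm] at this
      rw [this]
      simp [hε]
  -- a functional `φ` in the kernel is shown to vanish by induction on the power of `(x)` that it
  -- kills: then all `φ (x_j ·)` are zero, so `φ` is a multiple of the value at the origin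
  have hinj (k : ℕ) : ∀ φ : R →ₗ[ℂ] ℂ, contractWith β φ = 0 →
      (∀ p ∈ idealOfVars (Fin n) ℂ ^ k, φ (q p) = 0) → φ = 0 := by
    induction k with
    | zero =>
      intro φ _ h
      ext m
      obtain ⟨p, rfl⟩ := hq' m
      exact h p (by simp)
    | succ k ih =>
      intro φ h0 h
      have h1 := hann φ fun j => ih _ (by rw [hmul, h0, mul_zero]) fun p hp => by
        rw [LinearMap.comp_apply, LinearMap.mulLeft_apply, ← map_mul, h]
        rw [pow_succ']
        exact Ideal.mul_mem_mul (Ideal.subset_span (Set.mem_range_self j)) hp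
      rw [h1, map_smul, smul_eq_zero] at h0
      rw [h1, h0.resolve_right hβ0, zero_smul]
  have hinj' : Function.Injective (contractWith β) := by
    rw [injective_iff_map_eq_zero]
    exact fun φ h => hinj N φ h fun p hp => by rw [(hq p).2 (hN hp), map_zero]
  have hsurj : Function.Surjective (contractWith β) :=
    (LinearMap.injective_iff_surjective_of_finrank_eq_finrank
      (Subspace.dual_finrank_eq (K := ℂ) (V := R))).1 hinj'
  refine ⟨contractWith β ε.toLinearMap, fun s hs => ?_⟩
  obtain ⟨φ, rfl⟩ := hsurj s
  refine ⟨φ 1, ?_⟩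
  rw [← map_smul, ← hann φ fun j => hinj' ?_]
  rw [hmul, map_zero]
  exact hs j

end Bezoutian

/-! ### The Jacobian determinant, residues and associated forms -/

section Socle

variable {n : ℕ} {d : Fin n → ℕ} {f : Fin n → S n}

theorem sum_sub_one_eq_socleDegree (hd : ∀ j, 1 ≤ d j) : ∑ j, (d j - 1) = socleDegree d := by
  have h : ∑ j, (d j - 1) + n = ∑ j, d j := by
    have : ∑ j, d j = ∑ j, ((d j - 1) + 1) :=
      Finset.sum_congr rfl fun j _ => (Nat.sub_add_cancel (hd j)).symm
    simp [this, Finset.sum_add_distrib]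
  rw [socleDegree]
  omega

theorem jac_isHomogeneous (hd : ∀ j, 1 ≤ d j) (hf : ∀ j, (f j).IsHomogeneous (d j)) :
    (jac f).IsHomogeneous (socleDegree d) := by
  rw [jac, Matrix.det_apply, ← sum_sub_one_eq_socleDegree hd]
  refine IsHomogeneous.sum _ _ _ fun τ _ => ?_
  have h : (∏ i, (Matrix.of fun i j => pderiv j (f i)) (τ i) i).IsHomogeneous
      (∑ i, (d i - 1)) := by
    rw [← Equiv.sum_comp τ]
    exact IsHomogeneous.prod _ _ _ fun i _ => (hf (τ i)).pderiv
  rcases Int.units_eq_one_or (Equiv.Perm.sign τ) with h1 | h1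
  · simpa [h1] using h
  · simpa [h1] using h.neg

/-- Cramer's rule for the Jacobian matrix, which maps the vector of variables into `J(f)` by Euler's
identity. -/
theorem X_mul_jac_mem (hf : ∀ j, (f j).IsHomogeneous (d j)) (i : Fin n) : X i * jac f ∈ J f := by
  rw [mul_comm, jac, ← adjugate_mulVec_mulVec_apply _ X i, Matrix.mulVec, dotProduct]
  refine Ideal.sum_mem _ fun k _ => Ideal.mul_mem_left _ _ ?_
  have h : (Matrix.of fun i j => pderiv j (f i)).mulVec X k = d k • f k := by
    rw [← (hf k).sum_X_mul_pderiv]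
    rw [Matrix.mulVec, dotProduct]
    exact Finset.sum_congr rfl fun j _ => mul_comm (pderiv j (f k)) (X j)
  rw [h]
  exact Submodule.smul_of_tower_mem _ _ (Ideal.subset_span ⟨k, rfl⟩)

/-- By Euler's identity the Jacobian matrix, with its rows divided by the degrees, expresses `f`
through the variables. -/
theorem jac_notMem (hd : ∀ j, 1 ≤ d j) (h : IsZeroDimCI d f) : jac f ∉ J f := by
  obtain ⟨N, hN⟩ := (isZeroDimCI_iff hd h.homogeneous).1 h
  intro hj
  refine det_notMem_J hN
    (A := Matrix.of fun i j => C ((d i : ℂ)⁻¹) * (Matrix.of fun i j => pderiv j (f i)) i j)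
    (fun i => ?_) ?_
  · have h1 : (d i : ℂ) ≠ 0 := by
      have := hd i
      exact_mod_cast (by omega : d i ≠ 0)
    have h2 := congrArg (fun p => C ((d i : ℂ)⁻¹) * p) (h.homogeneous i).sum_X_mul_pderiv
    simp only [Finset.mul_sum, nsmul_eq_mul] at h2
    rw [← map_natCast (C : ℂ →+* S n), ← mul_assoc, ← C_mul, inv_mul_cancel₀ h1, C_1, one_mul] at h2
    rw [← h2]
    exact Finset.sum_congr rfl fun j _ => by simp only [Matrix.of_apply]; ring
  · rw [Matrix.det_mul_column]
    exact Ideal.mul_mem_left _ _ hj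

theorem constantCoeff_eq_zero (hd : ∀ j, 1 ≤ d j) (hf : ∀ j, (f j).IsHomogeneous (d j))
    (j : Fin n) : constantCoeff (f j) = 0 := by
  rw [constantCoeff_eq]
  exact (hf j).coeff_eq_zero (by rw [map_zero]; have := hd j; omega)

theorem mk_mem_socle_iff {p : S n} :
    Ideal.Quotient.mk (J f) p ∈ socle f ↔ ∀ i, X i * p ∈ J f := by
  refine forall_congr' fun i => ?_
  rw [← map_mul, Ideal.Quotient.eq_zero_iff_mem]

/-- The socle is spanned by the class of the Jacobian determinant. -/
theorem exists_sub_C_mul_jac_mem (hd : ∀ j, 1 ≤ d j) (h : IsZeroDimCI d f) {p : S n}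
    (hp : ∀ i, X i * p ∈ J f) : ∃ c : ℂ, p - C c * jac f ∈ J f := by
  obtain ⟨N, hN⟩ := (isZeroDimCI_iff hd h.homogeneous).1 h
  have := h.moduleFinite
  have hf := constantCoeff_eq_zero hd h.homogeneous
  obtain ⟨t, ht⟩ := exists_annihilated_eq_smul (q := Ideal.Quotient.mkₐ ℂ (J f))
    (ε := evalZero f hf) hN hf (fun p => Ideal.Quotient.eq_zero_iff_mem)
    Ideal.Quotient.mk_surjective (evalZero_mk f hf)
  obtain ⟨a, ha⟩ := ht _ (mk_mem_socle_iff.2 hp)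
  obtain ⟨b, hb⟩ := ht _ (mk_mem_socle_iff.2 (X_mul_jac_mem h.homogeneous))
  have hb0 : b ≠ 0 := by
    rintro rfl
    rw [zero_smul, Ideal.Quotient.eq_zero_iff_mem] at hb
    exact jac_notMem hd h hb
  refine ⟨a * b⁻¹, ?_⟩
  rw [← Ideal.Quotient.eq_zero_iff_mem, map_sub, C_mul', sub_eq_zero, ha]
  have : Ideal.Quotient.mk (J f) ((a * b⁻¹) • jac f)
      = (a * b⁻¹) • Ideal.Quotient.mk (J f) (jac f) := map_smul (Ideal.Quotient.mkₐ ℂ (J f)) _ _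
  rw [this, hb, smul_smul, mul_assoc, inv_mul_cancel₀ hb0, mul_one]

/-- The socle is concentrated in degree `T`. -/
theorem mem_of_isHomogeneous_of_ne (hd : ∀ j, 1 ≤ d j) (h : IsZeroDimCI d f) {p : S n} {k : ℕ}
    (hk : k ≠ socleDegree d) (hpk : p.IsHomogeneous k) (hp : ∀ i, X i * p ∈ J f) : p ∈ J f := by
  obtain ⟨c, hc⟩ := exists_sub_C_mul_jac_mem hd h hp
  have h1 := homogeneousComponent_mem_span h.homogeneous hc k
  rw [map_sub, homogeneousComponent_C_mul, homogeneousComponent_eq_self hpk,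
    homogeneousComponent_of_mem (jac_isHomogeneous hd h.homogeneous), if_neg hk, mul_zero,
    sub_zero] at h1
  exact h1

/-- All forms of degree greater than `T` lie in `J(f)`: by descending induction on the degree they
are in the socle modulo `J(f)`, which is concentrated in degree `T`. -/
theorem pow_socleDegree_succ_le (hd : ∀ j, 1 ≤ d j) (h : IsZeroDimCI d f) :
    idealOfVars (Fin n) ℂ ^ (socleDegree d + 1) ≤ J f := by
  obtain ⟨N, hN⟩ := (isZeroDimCI_iff hd h.homogeneous).1 h
  have key (m : ℕ) : idealOfVars (Fin n) ℂ ^ (socleDegree d + 1 + m) ≤ J f →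
      idealOfVars (Fin n) ℂ ^ (socleDegree d + 1) ≤ J f := by
    induction m with
    | zero => exact id
    | succ m ih =>
      refine fun hm => ih (pow_idealOfVars_le_of_monomial_mem fun a ha => ?_)
      have ha' : (monomial a (1 : ℂ)).IsHomogeneous _ := isHomogeneous_monomial 1 ha
      refine mem_of_isHomogeneous_of_ne hd h (by omega) ha' fun i => hm ?_
      exact mem_pow_idealOfVars_of_isHomogeneous ((isHomogeneous_X _ i).mul ha') (by omega)
  exact key N ((Ideal.pow_le_pow_right (by omega)).trans hN)

theorem X_mul_mem_of_isHomogeneous (hd : ∀ j, 1 ≤ d j) (h : IsZeroDimCI d f) {p : S n}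
    (hp : p.IsHomogeneous (socleDegree d)) (i : Fin n) : X i * p ∈ J f :=
  pow_socleDegree_succ_le hd h
    (mem_pow_idealOfVars_of_isHomogeneous ((isHomogeneous_X _ i).mul hp) (by omega))

theorem exists_socle_equiv (hd : ∀ j, 1 ≤ d j) (h : IsZeroDimCI d f) :
    ∃ ω : socle f ≃ₗ[ℂ] ℂ, ∃ hj : Ideal.Quotient.mk (J f) (jac f) ∈ socle f, ω ⟨_, hj⟩ = 1 := by
  have hj := mk_mem_socle_iff.2 (X_mul_jac_mem h.homogeneous)
  let e : ℂ →ₗ[ℂ] socle f := LinearMap.toSpanSingleton ℂ _ ⟨_, hj⟩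
  have hinj : Function.Injective e := by
    rw [injective_iff_map_eq_zero]
    intro c hc
    refine (smul_eq_zero.1 hc).resolve_right fun h0 => jac_notMem hd h ?_
    exact Ideal.Quotient.eq_zero_iff_mem.1 (congrArg Subtype.val h0)
  have hsurj : Function.Surjective e := by
    rintro ⟨s, hs⟩
    obtain ⟨p, rfl⟩ := Ideal.Quotient.mk_surjective s
    obtain ⟨c, hc⟩ := exists_sub_C_mul_jac_mem hd h (mk_mem_socle_iff.1 hs)
    refine ⟨c, Subtype.ext ?_⟩
    rw [← Ideal.Quotient.eq_zero_iff_mem, map_sub, C_mul', sub_eq_zero] at hc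
    exact ((map_smul (Ideal.Quotient.mkₐ ℂ (J f)) c (jac f)).symm.trans hc.symm)
  refine ⟨(LinearEquiv.ofBijective e ⟨hinj, hsurj⟩).symm, hj, ?_⟩
  rw [LinearEquiv.symm_apply_eq]
  exact (one_smul ℂ _).symm

theorem mk_sum_pow (y : Fin n → ℂ) (m : ℕ) :
    (∑ i, y i • Ideal.Quotient.mk (J f) (X i)) ^ m
      = Ideal.Quotient.mk (J f) ((∑ i, C (y i) * X i) ^ m) := by
  rw [map_pow, map_sum]
  congr 1
  refine Finset.sum_congr rfl fun i _ => ?_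
  rw [C_mul']
  exact (map_smul (Ideal.Quotient.mkₐ ℂ (J f)) _ _).symm

theorem isHomogeneous_linearForm_pow (y : Fin n → ℂ) (m : ℕ) :
    ((∑ i, C (y i) * X i : S n) ^ m).IsHomogeneous m := by
  have := (IsHomogeneous.sum Finset.univ (fun i => (C (y i) * X i : S n)) 1
    fun i _ => isHomogeneous_C_mul_X _ _).pow m
  rwa [one_mul] at this

/-- A linear functional on `S` that vanishes on `J(f)` and takes the value `1` on the Jacobian
determinant. It induces `ω` on the socle. -/
structure IsResidue (f : Fin n → S n) (L : S n →ₗ[ℂ] ℂ) : Prop where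
  map_eq_zero : ∀ p ∈ J f, L p = 0
  map_jac : L (jac f) = 1

theorem IsResidue.sub_mem {L : S n →ₗ[ℂ] ℂ} (hL : IsResidue f L) (hd : ∀ j, 1 ≤ d j)
    (h : IsZeroDimCI d f) {p : S n} (hp : ∀ i, X i * p ∈ J f) : p - C (L p) * jac f ∈ J f := by
  obtain ⟨c, hc⟩ := exists_sub_C_mul_jac_mem hd h hp
  have h1 := hL.map_eq_zero _ hc
  rw [map_sub, C_mul', map_smul, hL.map_jac, smul_eq_mul, mul_one, sub_eq_zero] at h1
  rwa [h1]

/-- Any residue computes the associated form, which is therefore unique. -/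
theorem IsAssociatedForm.eq_powerForm {A : MvPolynomial (Fin n) ℂ} (hd : ∀ j, 1 ≤ d j)
    (h : IsZeroDimCI d f) (hA : IsAssociatedForm d f A) {L : S n →ₗ[ℂ] ℂ} (hL : IsResidue f L) :
    A = powerForm (socleDegree d) L := by
  obtain ⟨ω, ⟨hj, hω⟩, hA⟩ := hA
  refine MvPolynomial.funext fun y => ?_
  obtain ⟨hs, hy⟩ := hA y
  rw [hy, eval_powerForm]
  have h1 := hL.sub_mem hd h fun i =>
    X_mul_mem_of_isHomogeneous hd h (isHomogeneous_linearForm_pow y _) i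
  rw [← Ideal.Quotient.eq_zero_iff_mem, map_sub, C_mul', sub_eq_zero, ← mk_sum_pow] at h1
  set c := L ((∑ i, C (y i) * X i) ^ socleDegree d)
  have h2 : (⟨_, hs⟩ : socle f) = c • ⟨_, hj⟩ :=
    Subtype.ext (h1.trans (map_smul (Ideal.Quotient.mkₐ ℂ (J f)) c (jac f)))
  rw [h2, map_smul, hω, smul_eq_mul, mul_one]

theorem exists_isAssociatedForm_powerForm (hd : ∀ j, 1 ≤ d j) (h : IsZeroDimCI d f) :
    ∃ L : S n →ₗ[ℂ] ℂ, IsResidue f L ∧ IsAssociatedForm d f (powerForm (socleDegree d) L) := by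
  obtain ⟨ω, hj, hω⟩ := exists_socle_equiv hd h
  obtain ⟨L', hL'⟩ := LinearMap.exists_extend ω.toLinearMap
  have hL (s : socle f) : L' s.1 = ω s := LinearMap.congr_fun hL' s
  let L : S n →ₗ[ℂ] ℂ := L' ∘ₗ (Ideal.Quotient.mkₐ ℂ (J f)).toLinearMap
  have hmk (p : S n) : L p = L' (Ideal.Quotient.mk (J f) p) := rfl
  refine ⟨L, ⟨fun p hp => ?_, ?_⟩, ω, ⟨hj, hω⟩, fun y => ?_⟩
  · rw [hmk, Ideal.Quotient.eq_zero_iff_mem.2 hp, map_zero]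
  · rw [hmk, hL ⟨_, hj⟩, hω]
  · have hs : (∑ i, y i • Ideal.Quotient.mk (J f) (X i)) ^ socleDegree d ∈ socle f := by
      rw [mk_sum_pow]
      exact mk_mem_socle_iff.2 fun i =>
        X_mul_mem_of_isHomogeneous hd h (isHomogeneous_linearForm_pow y _) i
    refine ⟨hs, ?_⟩
    rw [eval_powerForm, hmk, ← mk_sum_pow, hL ⟨_, hs⟩]

theorem existsUnique_isAssociatedForm (hd : ∀ j, 1 ≤ d j) (h : IsZeroDimCI d f) :
    ∃! A, IsAssociatedForm d f A := by
  obtain ⟨L, hL, hA⟩ := exists_isAssociatedForm_powerForm hd h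
  exact ⟨_, hA, fun B hB => hB.eq_powerForm hd h hL⟩

/-- The partial derivatives of `A` at `y` are, up to a factor, the values of the residue at the
`x_i ℓ ^ (T - 1)`, where `ℓ = y_1 x_1 + ⋯ + y_n x_n`. If all of them vanish, then `ℓ ^ (T - 1)` is
in the socle, which has no elements of degree `T - 1`. -/
theorem isSmoothHypersurface_powerForm_iff (hd : ∀ j, 1 ≤ d j) (hT : socleDegree d ≠ 0)
    (h : IsZeroDimCI d f) {L : S n →ₗ[ℂ] ℂ} (hL : IsResidue f L) :
    IsSmoothHypersurface (powerForm (socleDegree d) L) ↔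
      ∀ y : Fin n → ℂ, (∑ i, C (y i) * X i) ^ (socleDegree d - 1) ∈ J f → y = 0 := by
  rw [isSmoothHypersurface_iff hT (isHomogeneous_powerForm _ _)]
  refine forall_congr' fun y => imp_congr_left ?_
  obtain ⟨t, ht⟩ := Nat.exists_eq_succ_of_ne_zero hT
  have h0 : (t : ℂ) + 1 ≠ 0 := Nat.cast_add_one_ne_zero t
  simp only [ht, Nat.succ_eq_add_one, pderiv_powerForm, map_mul, eval_C, mul_eq_zero, h0,
    false_or, eval_powerForm, LinearMap.comp_apply, LinearMap.mulLeft_apply, Nat.add_sub_cancel]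
  constructor
  · intro hy
    refine mem_of_isHomogeneous_of_ne hd h (by omega) (isHomogeneous_linearForm_pow y t) fun i => ?_
    have h1 : (X i * (∑ i, C (y i) * X i) ^ t : S n).IsHomogeneous (socleDegree d) := by
      rw [ht, Nat.succ_eq_one_add]
      exact (isHomogeneous_X _ _).mul (isHomogeneous_linearForm_pow y t)
    have h2 := hL.sub_mem hd h fun j => X_mul_mem_of_isHomogeneous hd h h1 j
    rwa [hy i, C_0, zero_mul, sub_zero] at h2
  · intro hy i
    exact hL.map_eq_zero _ (Ideal.mul_mem_left _ _ hy)

theorem missesVeronese_iff :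
    MissesVeronese d f ↔
      ∀ y : Fin n → ℂ, (∑ i, C (y i) * X i) ^ (socleDegree d - 1) ∈ J f → y = 0 := by
  rw [MissesVeronese, Set.eq_empty_iff_forall_notMem]
  constructor
  · intro h y hy
    by_contra hne
    let l : Forms n 1 := ⟨∑ i, C (y i) * X i,
      by simpa using isHomogeneous_linearForm_pow y 1⟩
    have hl : l ≠ 0 := by
      intro h0
      obtain ⟨i, hi⟩ := Function.ne_iff.1 hne
      have h1 := congrArg (fun p : Forms n 1 => coeff (Finsupp.single i 1) p.1) h0
      simp [l, coeff_sum, coeff_C_mul, coeff_X, Finsupp.single_left_inj] at h1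
      exact hi h1
    refine h (veroneseMap n _ (Projectivization.mk ℂ l hl)) ⟨?_, ⟨_, rfl⟩⟩
    rw [veroneseMap, Projectivization.lift_mk]
    rw [projSubspace, Set.mem_ofPred_eq, Projectivization.submodule_mk,
      Submodule.span_singleton_le_iff_mem]
    exact hy
  · rintro h _ ⟨h1, q, rfl⟩
    induction q using Projectivization.ind with
    | h l hl =>
      rw [veroneseMap, Projectivization.lift_mk, projSubspace, Set.mem_ofPred_eq,
        Projectivization.submodule_mk, Submodule.span_singleton_le_iff_mem] at h1
      obtain ⟨y, hy⟩ : ∃ y : Fin n → ℂ, l.1 = ∑ i, C (y i) * X i := by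
        have h2 : l.1 ∈ Submodule.span ℂ (Set.range (X : Fin n → S n)) := by
          rw [← homogeneousSubmodule_one_eq_span_X]
          exact l.2
        obtain ⟨y, hy⟩ := (Submodule.mem_span_range_iff_exists_fun ℂ).1 h2
        exact ⟨y, by simp only [← hy, C_mul']⟩
      have h3 : l.1 ^ (socleDegree d - 1) ∈ J f := h1
      rw [hy] at h3
      refine hl (Subtype.ext ?_)
      rw [hy, h y h3]
      simp

end Socle

/-! ### A complete intersection with smooth associated form -/

theorem sum_neg_one_pow_mul_choose_mul_pow {N j : ℕ} (h : j < N) :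
    ∑ k ∈ Finset.range (N + 1), (-1 : ℂ) ^ k * (N.choose k : ℂ) * (k : ℂ) ^ j = 0 := by
  have h1 := congrFun (fwdDiff_iter_pow_eq_zero_of_lt (R := ℂ) h) 0
  rw [fwdDiff_iter_eq_sum_shift, Pi.zero_apply] at h1
  have h2 : ∑ k ∈ Finset.range (N + 1), (-1 : ℂ) ^ k * (N.choose k : ℂ) * (k : ℂ) ^ j
      = (-1) ^ N * ∑ k ∈ Finset.range (N + 1),
        ((-1 : ℤ) ^ (N - k) * N.choose k) • (fun r : ℂ => r ^ j) (0 + k • 1) := by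
    rw [Finset.mul_sum]
    refine Finset.sum_congr rfl fun k hk => ?_
    have hk : k ≤ N := Nat.lt_succ_iff.1 (Finset.mem_range.1 hk)
    have h3 : (-1 : ℂ) ^ N * (-1) ^ (N - k) = (-1) ^ k := by
      rw [← pow_add, show N + (N - k) = 2 * (N - k) + k by omega, pow_add, pow_mul]
      simp
    simp only [zsmul_eq_mul, nsmul_eq_mul, mul_one, zero_add]
    push_cast
    rw [← h3]
    ring
  rw [h2, h1, mul_zero]

section Grid

variable {m : ℕ} (d : Fin (m + 1) → ℕ)

/-- The points `(1, a_1, …, a_m)` with `0 ≤ a_i < d_i`. -/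
def grid : Finset (Fin m → ℕ) := Fintype.piFinset fun i => Finset.range (d i.succ)

/-- The point `(1, a_1, …, a_m)`. -/
noncomputable def gridPoint (a : Fin m → ℕ) : Fin (m + 1) → ℂ := Fin.cons 1 fun i => (a i : ℂ)

/-- The product of the weights of the finite difference operators of orders `d_i - 1`, up to sign. -/
noncomputable def gridWeight (a : Fin m → ℕ) : ℂ :=
  ∏ i, ((-1) ^ a i * ((d i.succ - 1).choose (a i) : ℂ))

/-- The value of `u (u - 1)` at `u = a_1 + ⋯ + a_m`, which is zero exactly at the origin and the
coordinate vectors. -/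
noncomputable def gridValue (a : Fin m → ℕ) : ℂ := (∑ i, (a i : ℂ)) * (∑ i, (a i : ℂ) - 1)

/-- The complete intersection whose last `m` members cut out the grid and whose first member takes
the value `u (u - 1) + t` on it. -/
noncomputable def gridForms (t : ℂ) : Fin (m + 1) → S (m + 1) :=
  Fin.cons (((∑ i : Fin m, X i.succ) * (∑ i : Fin m, X i.succ - X 0) + C t * X 0 ^ 2)
      * X 0 ^ (d 0 - 2))
    fun i => ∏ k ∈ Finset.range (d i.succ), (X i.succ - C (k : ℂ) * X 0)

variable {d}

theorem gridForms_isHomogeneous (hd : ∀ j, 2 ≤ d j) (t : ℂ) (j : Fin (m + 1)) :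
    (gridForms d t j).IsHomogeneous (d j) := by
  refine Fin.cases ?_ (fun i => ?_) j
  · have hu : (∑ i : Fin m, X i.succ : S (m + 1)).IsHomogeneous 1 :=
      IsHomogeneous.sum _ _ _ fun i _ => isHomogeneous_X _ _
    have h2 : ((∑ i : Fin m, X i.succ) * (∑ i : Fin m, X i.succ - X 0) + C t * X 0 ^ 2 :
        S (m + 1)).IsHomogeneous 2 :=
      (hu.mul (hu.sub (isHomogeneous_X _ _))).add (isHomogeneous_C_mul_X_pow _ _ _)
    have := h2.mul (isHomogeneous_X_pow (R := ℂ) (0 : Fin (m + 1)) (d 0 - 2))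
    rwa [Nat.add_sub_cancel' (hd 0)] at this
  · have := IsHomogeneous.prod (Finset.range (d i.succ))
      (fun k => (X i.succ - C (k : ℂ) * X 0 : S (m + 1))) (fun _ => 1)
      fun k _ => (isHomogeneous_X _ _).sub (isHomogeneous_C_mul_X _ _)
    simpa [gridForms] using this

/-- For a natural number `u` the product `u (u - 1)` is not negative. -/
theorem natCast_mul_sub_one_add_ne_zero (u : ℕ) {t : ℝ} (ht : 0 < t) :
    (u : ℂ) * ((u : ℂ) - 1) + (t : ℂ) ≠ 0 := by
  have h : 0 < (u : ℝ) * ((u : ℝ) - 1) + t := by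
    rcases Nat.eq_zero_or_pos u with rfl | hu
    · simpa using ht
    · have h1 : (1 : ℝ) ≤ u := by exact_mod_cast hu
      have : 0 ≤ (u : ℝ) * ((u : ℝ) - 1) := mul_nonneg (by linarith) (by linarith)
      linarith
  exact_mod_cast h.ne'

theorem gridValue_add_ne_zero (a : Fin m → ℕ) {t : ℝ} (ht : 0 < t) :
    gridValue a + (t : ℂ) ≠ 0 := by
  have := natCast_mul_sub_one_add_ne_zero (∑ i, a i) ht
  rwa [Nat.cast_sum] at this

theorem gridForms_isZeroDimCI (hd : ∀ j, 2 ≤ d j) {t : ℝ} (ht : 0 < t) :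
    IsZeroDimCI d (gridForms d t) := by
  refine (isZeroDimCI_iff (fun j => by have := hd j; omega) (gridForms_isHomogeneous hd _)).2
    (exists_pow_idealOfVars_le fun y hy => ?_)
  have h0 := hy _ (Ideal.subset_span ⟨0, rfl⟩)
  have h1 (i : Fin m) := hy _ (Ideal.subset_span ⟨i.succ, rfl⟩)
  have h2 (i : Fin m) : ∃ k : ℕ, y i.succ = k * y 0 := by
    have := h1 i
    simp only [gridForms, Fin.cons_succ, map_prod, Finset.prod_eq_zero_iff] at this
    obtain ⟨k, -, hk⟩ := this
    exact ⟨k, by simpa [sub_eq_zero] using hk⟩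
  choose k hk using h2
  have hy0 : y 0 = 0 := by
    -- otherwise the point lies on the grid, up to scaling, where the first form has no zero
    by_contra hne
    simp only [gridForms, Fin.cons_zero, map_mul, map_add, map_sub, map_sum, map_pow, eval_X,
      eval_C, hk, ← Finset.sum_mul] at h0
    refine natCast_mul_sub_one_add_ne_zero (∑ i, k i) ht ?_
    rw [mul_eq_zero, or_iff_left (pow_ne_zero _ hne)] at h0
    have h3 : ((∑ i, (k i : ℂ)) * ((∑ i, (k i : ℂ)) - 1) + t) * y 0 ^ 2 = 0 := by
      rw [← h0]; ring
    rw [Nat.cast_sum]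
    exact (mul_eq_zero.1 h3).resolve_right (pow_ne_zero _ hne)
  ext j
  refine Fin.cases hy0 (fun i => ?_) j
  rw [hk, hy0, mul_zero, Pi.zero_apply]

theorem eval_gridForms_succ (t : ℂ) {a : Fin m → ℕ} (ha : a ∈ grid d) (i : Fin m) :
    eval (gridPoint a) (gridForms d t i.succ) = 0 := by
  simp only [gridForms, Fin.cons_succ, map_prod]
  exact Finset.prod_eq_zero (Fintype.mem_piFinset.1 ha i) (by simp [gridPoint])

theorem eval_gridForms_zero (t : ℂ) (a : Fin m → ℕ) :
    eval (gridPoint a) (gridForms d t 0) = gridValue a + t := by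
  simp [gridForms, gridPoint, gridValue]

/-- A product of finite difference operators kills every monomial whose degree is smaller than the
total order. -/
theorem sum_gridWeight_mul_eval_monomial (hd : ∀ j, 2 ≤ d j) {b : Fin (m + 1) →₀ ℕ}
    (hb : ∑ i : Fin m, b i.succ < ∑ i : Fin m, (d i.succ - 1)) (r : ℂ) :
    ∑ a ∈ grid d, gridWeight d a * eval (gridPoint a) (monomial b r) = 0 := by
  obtain ⟨i, -, hi⟩ := Finset.exists_lt_of_sum_lt hb
  have h1 (a : Fin m → ℕ) : gridWeight d a * eval (gridPoint a) (monomial b r)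
      = r * ∏ i, ((-1) ^ a i * ((d i.succ - 1).choose (a i) : ℂ) * (a i : ℂ) ^ b i.succ) := by
    rw [eval_monomial, Finsupp.prod_fintype _ _ (by simp), Fin.prod_univ_succ, gridWeight,
      Finset.prod_mul_distrib (g := fun i => (a i : ℂ) ^ b i.succ)]
    simp only [gridPoint, Fin.cons_zero, Fin.cons_succ, one_pow, one_mul]
    ring
  simp only [h1]
  rw [← Finset.mul_sum, grid, ← Finset.prod_univ_sum (fun i => Finset.range (d i.succ))
    fun (i : Fin m) (k : ℕ) => (-1 : ℂ) ^ k * ((d i.succ - 1).choose k : ℂ) * (k : ℂ) ^ b i.succ]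
  have h2 := sum_neg_one_pow_mul_choose_mul_pow hi
  rw [Nat.sub_add_cancel (by have := hd i.succ; omega)] at h2
  rw [Finset.prod_eq_zero (Finset.mem_univ i) h2, mul_zero]

variable (d) in
/-- The functional `p ↦ ∑ c_a p(1, a)` on the forms of degree `T`, extended by zero to the other
degrees, so that its vanishing on an ideal generated by forms can be tested on homogeneous
elements. -/
noncomputable def gridFunctional (c : (Fin m → ℕ) → ℂ) : S (m + 1) →ₗ[ℂ] ℂ :=
  ∑ a ∈ grid d, c a • (aeval (gridPoint a)).toLinearMap ∘ₗ homogeneousComponent (socleDegree d)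

theorem gridFunctional_apply (c : (Fin m → ℕ) → ℂ) (p : S (m + 1)) :
    gridFunctional d c p
      = ∑ a ∈ grid d, c a * eval (gridPoint a) (homogeneousComponent (socleDegree d) p) := by
  simp [gridFunctional, aeval_eq_eval]

/-- The weights of the global residue on the grid, scaled by `t` so that they have a nonzero limit
for `t → 0`. -/
noncomputable def residueWeight (d : Fin (m + 1) → ℕ) (t : ℂ) (a : Fin m → ℕ) : ℂ :=
  gridWeight d a * (t / (gridValue a + t))

/-- The global residue vanishes on the ideal. -/
theorem gridFunctional_eq_zero (hd : ∀ j, 2 ≤ d j) {t : ℝ} (ht : 0 < t) {p : S (m + 1)}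
    (hp : p ∈ J (gridForms d t)) : gridFunctional d (residueWeight d t) p = 0 := by
  have key (j : Fin (m + 1)) (q : S (m + 1)) :
      gridFunctional d (residueWeight d t) (q * gridForms d t j) = 0 := by
    induction q using MvPolynomial.induction_on' with
    | add p q hp hq => rw [add_mul, map_add, hp, hq, add_zero]
    | monomial b r =>
      have hh : (monomial b r * gridForms d t j).IsHomogeneous (b.degree + d j) :=
        (isHomogeneous_monomial r rfl).mul (gridForms_isHomogeneous hd t j)
      rw [gridFunctional_apply, homogeneousComponent_of_mem hh]
      split_ifs with hT
      · simp only [map_mul]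
        revert hT hh
        refine Fin.cases (fun hh hT => ?_) (fun i _ _ => ?_) j
        · -- the value of the first form cancels the denominator of the weight
          have h1 : ∑ i : Fin m, b i.succ < ∑ i : Fin m, (d i.succ - 1) := by
            rw [← sum_sub_one_eq_socleDegree (fun j => by have := hd j; omega),
              Fin.sum_univ_succ, Finsupp.degree_eq_sum, Fin.sum_univ_succ] at hT
            have := hd 0
            omega
          rw [← mul_zero (t : ℂ), ← sum_gridWeight_mul_eval_monomial hd h1 r, Finset.mul_sum]
          refine Finset.sum_congr rfl fun a _ => ?_
          have := gridValue_add_ne_zero a ht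
          rw [eval_gridForms_zero, residueWeight]
          field_simp
        · exact Finset.sum_eq_zero fun a ha => by
            rw [eval_gridForms_succ _ ha, mul_zero, mul_zero]
      · simp
  rw [J] at hp
  obtain ⟨q, rfl⟩ := Ideal.mem_span_range_iff_exists_fun.1 hp
  rw [map_sum]
  exact Finset.sum_eq_zero fun j _ => key j _

/-- The weights of the part of the grid where `u (u - 1)` vanishes. -/
noncomputable def fermatWeight (d : Fin (m + 1) → ℕ) (a : Fin m → ℕ) : ℂ :=
  if gridValue a = 0 then gridWeight d a else 0

theorem tendsto_residueWeight (a : Fin m → ℕ) :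
    Filter.Tendsto (fun t : ℝ => residueWeight d (t : ℂ) a) (nhdsWithin 0 (Set.Ioi 0))
      (nhds (fermatWeight d a)) := by
  rw [fermatWeight]
  split_ifs with h
  · refine tendsto_const_nhds.congr' ?_
    filter_upwards [self_mem_nhdsWithin] with t ht
    have : (t : ℂ) ≠ 0 := by exact_mod_cast (Set.mem_Ioi.1 ht).ne'
    rw [residueWeight, h, zero_add, div_self this, mul_one]
  · have hc : ContinuousAt (fun t : ℝ => residueWeight d (t : ℂ) a) 0 := by
      unfold residueWeight
      refine continuousAt_const.mul (ContinuousAt.div ?_ ?_ ?_)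
      · exact Complex.continuous_ofReal.continuousAt
      · exact continuousAt_const.add Complex.continuous_ofReal.continuousAt
      · simpa using h
    have := hc.tendsto.mono_left (nhdsWithin_le_nhds (s := Set.Ioi (0 : ℝ)))
    simpa [residueWeight] using this

variable (d) in
/-- The family of forms `∑ c_a (y_0 + a_1 y_1 + ⋯ + a_m y_m) ^ T` with parameters `c_a`. -/
noncomputable def gridFamily : MvPolynomial (Fin (m + 1)) (MvPolynomial (Fin m → ℕ) ℂ) :=
  ∑ a ∈ grid d, C (X a) * (∑ i, C (C (gridPoint a i)) * X i) ^ socleDegree d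

theorem gridFamily_isHomogeneous : (gridFamily d).IsHomogeneous (socleDegree d) := by
  refine IsHomogeneous.sum _ _ _ fun a _ => IsHomogeneous.C_mul ?_ _
  have := (IsHomogeneous.sum Finset.univ (fun i => C (C (gridPoint a i)) * X i :
    Fin (m + 1) → MvPolynomial (Fin (m + 1)) (MvPolynomial (Fin m → ℕ) ℂ)) 1
    fun i _ => isHomogeneous_C_mul_X _ _).pow (socleDegree d)
  rwa [one_mul] at this

theorem map_gridFamily (c : (Fin m → ℕ) → ℂ) :
    map (eval c) (gridFamily d)
      = ∑ a ∈ grid d, C (c a) * (∑ i, C (gridPoint a i) * X i) ^ socleDegree d := by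
  simp [gridFamily]

theorem map_gridFamily_eq_powerForm (c : (Fin m → ℕ) → ℂ) :
    map (eval c) (gridFamily d) = powerForm (socleDegree d) (gridFunctional d c) := by
  refine MvPolynomial.funext fun y => ?_
  rw [map_gridFamily, eval_powerForm, gridFunctional_apply,
    homogeneousComponent_eq_self (isHomogeneous_linearForm_pow y _)]
  simp [mul_comm]

theorem eq_zero_or_eq_single_of_gridValue_eq_zero {a : Fin m → ℕ} (h : gridValue a = 0) :
    a = 0 ∨ ∃ i, a = Pi.single i 1 := by
  rw [gridValue, mul_eq_zero, sub_eq_zero] at h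
  rcases h with h | h
  · left
    have h1 : ∑ i, a i = 0 := by exact_mod_cast h
    exact funext fun i => Finset.sum_eq_zero_iff.1 h1 i (Finset.mem_univ i)
  · right
    have h1 : ∑ i, a i = 1 := by exact_mod_cast h
    obtain ⟨i, -, hi⟩ := Finset.exists_ne_zero_of_sum_ne_zero (h1.trans_ne one_ne_zero)
    have h2 := Finset.add_sum_erase Finset.univ a (Finset.mem_univ i)
    refine ⟨i, funext fun j => ?_⟩
    by_cases hj : j = i
    · subst hj
      rw [Pi.single_eq_same]
      omega
    · have h3 : a j ≤ ∑ k ∈ Finset.univ.erase i, a k :=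
        Finset.single_le_sum (fun _ _ => Nat.zero_le _) (Finset.mem_erase.2 ⟨hj, Finset.mem_univ j⟩)
      rw [Pi.single_eq_of_ne hj]
      omega

theorem fermatWeight_ne_zero {a : Fin m → ℕ} (h : gridValue a = 0) (ha : a ∈ grid d) :
    fermatWeight d a ≠ 0 := by
  rw [fermatWeight, if_pos h, gridWeight, Finset.prod_ne_zero_iff]
  intro i _
  have h1 : a i ≤ d i.succ - 1 := by
    have := Finset.mem_range.1 (Fintype.mem_piFinset.1 ha i)
    omega
  exact mul_ne_zero (pow_ne_zero _ (by simp)) (by exact_mod_cast (Nat.choose_pos h1).ne')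

theorem single_mem_grid (hd : ∀ j, 2 ≤ d j) (i : Fin m) : Pi.single i 1 ∈ grid d := by
  refine Fintype.mem_piFinset.2 fun j => Finset.mem_range.2 ?_
  have := hd j.succ
  by_cases hj : j = i
  · subst hj; rw [Pi.single_eq_same]; omega
  · rw [Pi.single_eq_of_ne hj]; omega

theorem gridValue_single (i : Fin m) : gridValue (Pi.single i 1) = 0 := by
  have h : ∑ j, ((Pi.single i 1 : Fin m → ℕ) j : ℂ) = 1 := by
    simp [Pi.single_apply]
  rw [gridValue, h, sub_self, mul_zero]

theorem eval_pderiv_gridFamily (c : (Fin m → ℕ) → ℂ) (y : Fin (m + 1) → ℂ) (j : Fin (m + 1)) :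
    eval y (pderiv j (map (eval c) (gridFamily d)))
      = socleDegree d * ∑ a ∈ grid d,
        c a * (y 0 + ∑ i, (a i : ℂ) * y i.succ) ^ (socleDegree d - 1) * gridPoint a j := by
  rw [map_gridFamily, map_sum, map_sum, Finset.mul_sum]
  refine Finset.sum_congr rfl fun a _ => ?_
  have h1 : pderiv j (∑ i, C (gridPoint a i) * X i : S (m + 1)) = C (gridPoint a j) := by
    simp [pderiv_X, Pi.single_apply]
  have h2 : eval y (∑ i, C (gridPoint a i) * X i : S (m + 1))
      = y 0 + ∑ i, (a i : ℂ) * y i.succ := by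
    simp [Fin.sum_univ_succ, gridPoint]
  rw [pderiv_C_mul, Derivation.leibniz_pow, h1]
  simp only [smul_eq_mul, nsmul_eq_mul, map_mul, map_pow, h2, eval_C, map_natCast]
  ring

/-- In the limit `t → 0` only the `m + 1` linearly independent points with `u (u - 1) = 0` survive,
and the limit is a Fermat form in suitable coordinates. -/
theorem isSmoothHypersurface_fermat (hd : ∀ j, 2 ≤ d j) (hT : 2 ≤ socleDegree d) :
    IsSmoothHypersurface (map (eval (fermatWeight d)) (gridFamily d)) := by
  refine (isSmoothHypersurface_iff (by omega) (gridFamily_isHomogeneous.map _)).2 fun y hy => ?_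
  have hT0 : (socleDegree d : ℂ) ≠ 0 := by exact_mod_cast (by omega : socleDegree d ≠ 0)
  have hT1 : socleDegree d - 1 ≠ 0 := by omega
  simp only [eval_pderiv_gridFamily, mul_eq_zero, hT0, false_or] at hy
  have hlin (i : Fin m) :
      y 0 + ∑ j, ((Pi.single i 1 : Fin m → ℕ) j : ℂ) * y j.succ = y 0 + y i.succ := by
    simp [Pi.single_apply]
  have hsucc (i : Fin m) : y 0 + y i.succ = 0 := by
    have h := hy i.succ
    rw [Finset.sum_eq_single (Pi.single i 1), hlin] at h
    · have h1 : gridPoint (Pi.single i 1 : Fin m → ℕ) i.succ = 1 := by simp [gridPoint]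
      rw [h1, mul_one, mul_eq_zero,
        or_iff_right (fermatWeight_ne_zero (gridValue_single i) (single_mem_grid hd i))] at h
      exact (pow_eq_zero_iff hT1).1 h
    · intro a _ ha
      by_cases hv : gridValue a = 0
      · rcases eq_zero_or_eq_single_of_gridValue_eq_zero hv with rfl | ⟨j, rfl⟩
        · simp [gridPoint]
        · have hij : i ≠ j := by rintro rfl; exact ha rfl
          simp [gridPoint, Pi.single_eq_of_ne hij]
      · rw [fermatWeight, if_neg hv, zero_mul, zero_mul]
    · intro h; exact absurd (single_mem_grid hd i) h
  have h0 : y 0 = 0 := by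
    have h := hy 0
    have hmem : (0 : Fin m → ℕ) ∈ grid d :=
      Fintype.mem_piFinset.2 fun j => Finset.mem_range.2 (by
        have := hd j.succ
        rw [Pi.zero_apply]
        omega)
    rw [Finset.sum_eq_single 0] at h
    · have h1 : gridPoint (0 : Fin m → ℕ) 0 = 1 := by simp [gridPoint]
      rw [h1, mul_one, mul_eq_zero,
        or_iff_right (fermatWeight_ne_zero (by simp [gridValue]) hmem)] at h
      simpa using (pow_eq_zero_iff hT1).1 h
    · intro a _ ha
      by_cases hv : gridValue a = 0
      · rcases eq_zero_or_eq_single_of_gridValue_eq_zero hv with rfl | ⟨j, rfl⟩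
        · exact absurd rfl ha
        · rw [hlin, hsucc, zero_pow hT1, mul_zero, zero_mul]
      · rw [fermatWeight, if_neg hv, zero_mul, zero_mul]
    · intro h; exact absurd hmem h
  ext j
  refine Fin.cases h0 (fun i => ?_) j
  simpa [h0] using hsucc i

/-- Smoothness at the limit `t = 0` of the family of associated forms implies smoothness for some
`t > 0`, where the members of the family belong to complete intersections. -/
theorem exists_smooth_example (hd : ∀ j, 2 ≤ d j) (hT : 2 ≤ socleDegree d) :
    ∃ f, IsZeroDimCI d f ∧ ∀ L, IsResidue f L →
      IsSmoothHypersurface (powerForm (socleDegree d) L) := by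
  have hd1 (j) : 1 ≤ d j := by have := hd j; omega
  obtain ⟨D, hD, h⟩ := exists_generic_isSmoothHypersurface (by omega) gridFamily_isHomogeneous
    (isSmoothHypersurface_fermat hd hT)
  have h1 : Filter.Tendsto (fun t : ℝ => eval (residueWeight d (t : ℂ)) D)
      (nhdsWithin 0 (Set.Ioi 0)) (nhds (eval (fermatWeight d) D)) :=
    (MvPolynomial.continuous_eval D).continuousAt.tendsto.comp
      (tendsto_pi_nhds.2 tendsto_residueWeight)
  obtain ⟨t, ht0, ht⟩ := ((h1.eventually_ne hD).and self_mem_nhdsWithin).exists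
  have hci := gridForms_isZeroDimCI hd ht
  refine ⟨_, hci, fun L hL => ?_⟩
  have h2 := h _ ht0
  rw [map_gridFamily_eq_powerForm] at h2
  set K := gridFunctional d (residueWeight d t)
  -- both functionals vanish on `J(f)`, so they are proportional in degree `T`
  have h3 : powerForm (socleDegree d) K
      = C (K (jac (gridForms d t))) * powerForm (socleDegree d) L := by
    refine MvPolynomial.funext fun y => ?_
    rw [map_mul, eval_C, eval_powerForm, eval_powerForm]
    have h4 := hL.sub_mem hd1 hci fun i =>
      X_mul_mem_of_isHomogeneous hd1 hci (isHomogeneous_linearForm_pow y _) i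
    have h5 := gridFunctional_eq_zero hd ht h4
    rw [map_sub, C_mul', map_smul, sub_eq_zero] at h5
    rw [h5, smul_eq_mul, mul_comm]
  rw [h3] at h2
  exact h2.of_C_mul

end Grid

/-! ### Passage to generic forms -/

section Generic

variable {n : ℕ} {d : Fin n → ℕ} {f : Fin n → S n}

/-- The point of the affine space `S_{d_1} × ⋯ × S_{d_n}` given by a tuple of forms. -/
noncomputable def coeffs (d : Fin n → ℕ) (f : Fin n → S n) : CoeffIndex d → ℂ :=
  fun a => coeff a.2.1 (f a.1)

/-- The tuple of forms of degrees `d_1, …, d_n` with indeterminate coefficients. -/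
noncomputable def genericForms (d : Fin n → ℕ) (j : Fin n) :
    MvPolynomial (Fin n) (MvPolynomial (CoeffIndex d) ℂ) :=
  letI := Fintype.ofFinite {a : Fin n →₀ ℕ // a.degree = d j}
  ∑ a : {a : Fin n →₀ ℕ // a.degree = d j}, monomial a.1 (X ⟨j, a⟩)

theorem genericForms_isHomogeneous (j : Fin n) : (genericForms d j).IsHomogeneous (d j) :=
  IsHomogeneous.sum _ _ _ fun a _ => isHomogeneous_monomial _ a.2

theorem map_genericForms (hf : ∀ j, (f j).IsHomogeneous (d j)) (j : Fin n) :
    map (eval (coeffs d f)) (genericForms d j) = f j := by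
  classical
  let _ := Fintype.ofFinite {a : Fin n →₀ ℕ // a.degree = d j}
  ext x
  simp only [genericForms, map_sum, map_monomial, eval_X, coeff_sum, coeff_monomial]
  by_cases hx : x.degree = d j
  · rw [Finset.sum_eq_single ⟨x, hx⟩, if_pos rfl]
    · rfl
    · intro a _ ha
      exact if_neg fun h => ha (Subtype.ext h)
    · simp
  · rw [(hf j).coeff_eq_zero hx]
    exact Finset.sum_eq_zero fun a _ => if_neg fun h : a.1 = x => hx (h ▸ a.2)

/-- The Jacobian determinant of the generic forms. -/
noncomputable def genericJac (d : Fin n → ℕ) :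
    MvPolynomial (Fin n) (MvPolynomial (CoeffIndex d) ℂ) :=
  (Matrix.of fun i j => pderiv j (genericForms d i)).det

theorem map_genericJac (hf : ∀ j, (f j).IsHomogeneous (d j)) :
    map (eval (coeffs d f)) (genericJac d) = jac f := by
  rw [genericJac, RingHom.map_det, jac]
  congr 1
  ext1 i j
  rw [RingHom.mapMatrix_apply, Matrix.map_apply, Matrix.of_apply, Matrix.of_apply, ← pderiv_map,
    map_genericForms hf]

theorem J_eq_span_map_genericForms (hf : ∀ j, (f j).IsHomogeneous (d j)) :
    J f = Ideal.span (Set.range fun j => map (eval (coeffs d f)) (genericForms d j)) := by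
  simp only [map_genericForms hf]
  rfl

/-- The linear functional with the values `ρ a` on the monomials `x^a`. -/
noncomputable def ofMonomials {k : Type*} [CommRing k] (ρ : (Fin n →₀ ℕ) → k) :
    MvPolynomial (Fin n) k →ₗ[k] k :=
  (basisMonomials (Fin n) k).constr k ρ

theorem ofMonomials_monomial {k : Type*} [CommRing k] (ρ : (Fin n →₀ ℕ) → k) (a : Fin n →₀ ℕ)
    (r : k) : ofMonomials ρ (monomial a r) = r * ρ a := by
  have h : monomial a r = r • basisMonomials (Fin n) k a := by
    rw [coe_basisMonomials, smul_monomial, smul_eq_mul, mul_one]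
  rw [h, map_smul, ofMonomials, Module.Basis.constr_basis, smul_eq_mul]

theorem ofMonomials_map {k k' : Type*} [CommRing k] [CommRing k'] (r : k →+* k')
    (ρ : (Fin n →₀ ℕ) → k) (p : MvPolynomial (Fin n) k) :
    ofMonomials (fun a => r (ρ a)) (map r p) = r (ofMonomials ρ p) := by
  induction p using MvPolynomial.induction_on' with
  | monomial a c => rw [map_monomial, ofMonomials_monomial, ofMonomials_monomial, map_mul]
  | add p q hp hq => simp only [map_add, hp, hq]

theorem ofMonomials_eq_mul {k : Type*} [CommRing k] {ρ : (Fin n →₀ ℕ) → k}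
    {L : MvPolynomial (Fin n) k →ₗ[k] k} {D : k} {N : ℕ}
    (h : ∀ a : Fin n →₀ ℕ, a.degree = N → D * L (monomial a 1) = ρ a) {p : MvPolynomial (Fin n) k}
    (hp : p.IsHomogeneous N) : ofMonomials ρ p = D * L p := by
  rw [p.as_sum, map_sum, map_sum, Finset.mul_sum]
  refine Finset.sum_congr rfl fun a ha => ?_
  have h1 : monomial a (coeff a p) = coeff a p • monomial a (1 : k) := by
    rw [smul_monomial, smul_eq_mul, mul_one]
  rw [ofMonomials_monomial, h1, map_smul, smul_eq_mul, mul_left_comm,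
    h a (by_contra fun hne => mem_support_iff.1 ha (hp.coeff_eq_zero hne))]

/-- If one complete intersection has a smooth associated form, then a generic one does: up to a
factor, the coefficients of the associated form are polynomials in those of `f`. -/
theorem holdsGenerically_of_exists (hd : ∀ j, 1 ≤ d j) (hT : socleDegree d ≠ 0)
    (h₀ : ∃ f, IsZeroDimCI d f ∧ ∀ L, IsResidue f L →
      IsSmoothHypersurface (powerForm (socleDegree d) L)) :
    HoldsGenerically d fun f => IsZeroDimCI d f ∧ ∀ L, IsResidue f L →
      IsSmoothHypersurface (powerForm (socleDegree d) L) := by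
  obtain ⟨f₀, hf₀, hs₀⟩ := h₀
  obtain ⟨D₁, hD₁, h₁⟩ := exists_generic_pow_le (c₀ := coeffs d f₀)
    (genericForms_isHomogeneous (d := d)) (N := socleDegree d + 1) (by
      rw [← J_eq_span_map_genericForms hf₀.homogeneous]
      exact pow_socleDegree_succ_le hd hf₀)
  obtain ⟨D₂, ρ, hD₂, h₂⟩ := exists_generic_reduction (genericForms d) (genericJac d)
    (socleDegree d) (coeffs d f₀) fun a ha => by
      rw [map_genericJac hf₀.homogeneous, ← J_eq_span_map_genericForms hf₀.homogeneous]
      exact exists_sub_C_mul_jac_mem hd hf₀ fun i =>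
        X_mul_mem_of_isHomogeneous hd hf₀ (isHomogeneous_monomial 1 ha) i
  -- the associated form of the generic tuple, with denominators cleared
  let B := powerForm (socleDegree d) (ofMonomials ρ)
  have hB (f : Fin n → S n) (hf : IsZeroDimCI d f) (L : S n →ₗ[ℂ] ℂ) (hL : IsResidue f L) :
      map (eval (coeffs d f)) B
        = C (eval (coeffs d f) D₂) * powerForm (socleDegree d) L := by
    rw [map_powerForm _ _ _ _ (ofMonomials_map (eval (coeffs d f)) ρ)]
    refine MvPolynomial.funext fun y => ?_
    rw [map_mul, eval_C, eval_powerForm, eval_powerForm]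
    refine ofMonomials_eq_mul (fun a ha => ?_) (isHomogeneous_linearForm_pow y _)
    have h := h₂ (coeffs d f) d (fun j => (genericForms_isHomogeneous j).map _)
      (by rw [map_genericJac hf.homogeneous]; exact jac_isHomogeneous hd hf.homogeneous) a ha
    rw [map_genericJac hf.homogeneous, ← J_eq_span_map_genericForms hf.homogeneous] at h
    have h3 := hL.map_eq_zero _ h
    rw [map_sub, C_mul', map_smul, hL.map_jac, smul_eq_mul, mul_one, sub_eq_zero] at h3
    rw [← h3, ← smul_eq_mul, ← map_smul, smul_monomial, smul_eq_mul, mul_one]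
  obtain ⟨L₀, hL₀, -⟩ := exists_isAssociatedForm_powerForm hd hf₀
  obtain ⟨D₃, hD₃, h₃⟩ := exists_generic_isSmoothHypersurface (c₀ := coeffs d f₀) hT
    (isHomogeneous_powerForm (socleDegree d) (ofMonomials ρ))
    (by rw [hB f₀ hf₀ L₀ hL₀]; exact (hs₀ L₀ hL₀).C_mul hD₂)
  refine ⟨D₁ * D₂ * D₃, fun h => ?_, fun f hf hΦ => ?_⟩
  · have := congrArg (eval (coeffs d f₀)) h
    simp [hD₁, hD₂, hD₃] at this
  · replace hΦ : eval (coeffs d f) (D₁ * D₂ * D₃) ≠ 0 := hΦ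
    rw [map_mul, map_mul, mul_ne_zero_iff, mul_ne_zero_iff] at hΦ
    have hci : IsZeroDimCI d f := (isZeroDimCI_iff hd hf).2
      ⟨_, (h₁ _ hΦ.1.1).trans (J_eq_span_map_genericForms hf).ge⟩
    refine ⟨hci, fun L hL => ?_⟩
    have h := h₃ _ hΦ.2
    rw [hB f hci L hL] at h
    exact h.of_C_mul

end Generic

end CompleteIntersection

theorem theorem1p3 (n : ℕ) (hn : 3 ≤ n) (d : Fin n → ℕ) (hd : ∀ j, 2 ≤ d j) (hmono : Monotone d) :
    -- the associated form is well defined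
    (∀ f, CompleteIntersection.IsZeroDimCI d f →
      ∃! A, CompleteIntersection.IsAssociatedForm d f A) ∧
    -- the two conditions are equivalent for every complete intersection
    (∀ f, CompleteIntersection.IsZeroDimCI d f →
      ∀ A, CompleteIntersection.IsAssociatedForm d f A →
        (CompleteIntersection.IsSmoothHypersurface A ↔
          CompleteIntersection.MissesVeronese d f)) ∧
    -- a generic tuple is a complete intersection and satisfies both conditions
    CompleteIntersection.HoldsGenerically d (fun f =>
      CompleteIntersection.IsZeroDimCI d f ∧
      (∃ A, CompleteIntersection.IsAssociatedForm d f A ∧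
        CompleteIntersection.IsSmoothHypersurface A) ∧
      CompleteIntersection.MissesVeronese d f) := by
  open CompleteIntersection in
  have hd1 (j) : 1 ≤ d j := one_le_two.trans (hd j)
  have hT : 2 ≤ socleDegree d := by
    have h1 : ∑ _j : Fin n, 1 ≤ ∑ j, (d j - 1) :=
      Finset.sum_le_sum fun j _ => by have := hd j; omega
    rw [sum_sub_one_eq_socleDegree hd1] at h1
    simp at h1
    omega
  have hiff (f) (hf : IsZeroDimCI d f) (L) (hL : IsResidue f L) :
      IsSmoothHypersurface (powerForm (socleDegree d) L) ↔ MissesVeronese d f :=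
    (isSmoothHypersurface_powerForm_iff hd1 (by omega) hf hL).trans missesVeronese_iff.symm
  refine ⟨fun f hf => existsUnique_isAssociatedForm hd1 hf, fun f hf A hA => ?_, ?_⟩
  · obtain ⟨L, hL, -⟩ := exists_isAssociatedForm_powerForm hd1 hf
    rw [hA.eq_powerForm hd1 hf hL]
    exact hiff f hf L hL
  · obtain ⟨m, rfl⟩ : ∃ m, n = m + 1 := ⟨n - 1, by omega⟩
    obtain ⟨Φ, hΦ, h⟩ := holdsGenerically_of_exists hd1 (by omega) (exists_smooth_example hd hT)
    refine ⟨Φ, hΦ, fun f hf hne => ?_⟩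
    obtain ⟨hci, hs⟩ := h f hf hne
    obtain ⟨L, hL, hA⟩ := exists_isAssociatedForm_powerForm hd1 hci
    exact ⟨hci, ⟨_, hA, hs L hL⟩, (hiff f hci L hL).1 (hs L hL)⟩
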